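/- **Theorem (Distributed confidence sets and safe-set inclusion).** *Setting.* Let $d\ge 2$, and let $N$ agents communicate over a connected undirected graph with a symmetric doubly stochastic weight matrix $W\in\mathbb R^{N\times N}$, where $W_{ij}=0$ if and only if $j\ne i$ is not a neighbour of $i$. Let $|\lambda_2|$ be the second largest absolute value of the eigenvalues of $W$, and assume $0<|\lambda_2|<1$. Agent $i$ has an unknown parameter $\theta^i_*\in\mathbb R^d$ with $\|\theta^i_*\|_2\le S$; put $\theta_*^{\rm global}=\frac1N\sum_i\theta^i_*$. The action set $\mathcal X\subset\mathbb R^d$ is compact and convex, $\|x\|_2\le L$ (with $L>0$) and $x^\top\theta_*^{\rm global}\in[0,1]$ on $\mathcal X$; $x^*\in\mathcal X$ maximizes $x^\top\theta_*^{\rm global}$ over $\mathcal X$. Baseline actions $x_{b,t}\in\mathcal X$ with $r_{b,t}=x_{b,t}^\top\theta_*^{\rm global}$ satisfy, for $1\le t\le T$, $0\le\kappa_l\le x^{*\top}\theta_*^{\rm global}-r_{b,t}\le\kappa_h$ and $0<r_l\le r_{b,t}\le r_h$. Let $\alpha,\delta\in(0,1)$, $\lambda>0$, $R\ge0$, $\rho=\frac{\alpha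 r_l}{S+r_h}$. *Episodes.* Let $q(s)=\big\lceil \log(2Ns)/\sqrt{2\log(1/|\lambda_2|)}\big\rceil$, $t_1=1$, $t_{s+1}=t_s+1+q(s)$, and let $M$ be the number of $s\ge1$ with $t_s+q(s)\le T$. In episode $s\le M$ the action $x_{t_s}\in\mathcal X$ is played and each agent $i$ observes $r^i_{t_s}=x_{t_s}^\top\theta^i_*+\eta^i_{t_s}$, where $|r^i_{t_s}|\le1$ almost surely. For $1\le t\le T$, given all information up to round $t-1$ and the random draws made at round $t$ before playing, the noises $\eta^1_t,\dots,\eta^N_t$ have mean zero, are $R$-sub-Gaussian ($\mathbb E[e^{c\eta^i_t}\mid\cdot]\le e^{c^2R^2/2}$ for all $c\in\mathbb R$) and are conditionally independent across agents. The agents then run $q(s)$ rounds of accelerated consensus: $v_0=(r^i_{t_s})_i$, $v_1=Wv_0$, $v_{h+1}=\frac{c_h}{c_{h+1}}\frac{2}{|\lambda_2|}Wv_h-\frac{c_{h-1}}{c_{h+1}}v_{h-1}$ with $c_0=1$, $c_1=1/|\lambda_2|$, $c_{h+1}=2c_h/|\lambda_2|-c_{h-1}$; let $y^i_s=(v_{q(s)})_i$.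 *Estimates.* With $\|x\|_A=\sqrt{x^\top Ax}$, put $$\Sigma_s=\lambda I+\sum_{k=1}^sx_{t_k}x_{t_k}^\top,\qquad \hat\theta^{i}_s=\Sigma_s^{-1}\sum_{k=1}^sx_{t_k}y^i_k,\qquad \mathcal E^i_s=\{\theta:\|\theta-\hat\theta^i_s\|_{\Sigma_s}\le\beta_s\},$$ $$\beta_s=\frac{R}{\sqrt N}\sqrt{d\log\Big(\frac{1+sL^2/\lambda}{\delta/(2N)}\Big)}+\sqrt\lambda\,S+\frac{L}{\sqrt\lambda},$$ and let the safe set of agent $i$ in episode $s$ be $$\mathcal X^{{\rm safe},i}_{s-1}=\Big\{x\in\mathcal X:\ \min_{v\in\mathcal E^i_{s-1}}x^\top v\ge(1-\alpha)r_{b,t_s}\Big\}.$$ *Action rule.* In episode $s$ an agent $a$, uniform on $\{1,\dots,N\}$ and independent of the past, and a direction $\zeta$, uniform on the unit sphere and independent of the past and of $a$, are drawn. If $\mathcal X^{{\rm safe},a}_{s-1}\ne\emptyset$ and $\lambda_{\min}(\Sigma_{s-1})\ge\big(\frac{2L\beta_{s-1}}{\kappa_l+\alpha r_l}\big)^2$,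 then $x_{t_s}$ is the first component of a maximizer of $x^\top\theta$ over $x\in\mathcal X^{{\rm safe},a}_{s-1}$, $\theta\in\mathcal E^a_{s-1}$ (chosen measurably from the available information); otherwise $x_{t_s}=(1-\rho)x_{b,t_s}+\rho\zeta$. *Conclusion.* With probability at least $1-\delta/2$ the following hold simultaneously. (i) $\theta_*^{\rm global}\in\mathcal E^i_s$ for all $0\le s\le M$ and all agents $i$. (ii) For every episode $1\le s\le M$ with $\lambda_{\min}(\Sigma_{s-1})\ge\big(\frac{2L\beta_{s-1}}{\kappa_l+\alpha r_l}\big)^2$ and every agent $i$: $x^*\in\mathcal X^{{\rm safe},i}_{s-1}$; the problem of maximizing $x^\top\theta$ over $x\in\mathcal X^{{\rm safe},i}_{s-1}$, $\theta\in\mathcal E^i_{s-1}$ has a solution; and every solution $(\bar x,\bar\theta)$ satisfies $\bar x^\top\bar\theta\ge x^{*\top}\theta_*^{\rm global}$. -/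

import Mathlib

open MeasureTheory ProbabilityTheory
open scoped RealInnerProductSpace Matrix

noncomputable section

namespace SafeBandit

/-! ### Linear algebra -/

/-- The weighted norm `‖v‖_A = √(vᵀ A v)`. -/
def weightedNorm {d : ℕ} (A : Matrix (Fin d) (Fin d) ℝ) (v : EuclideanSpace ℝ (Fin d)) : ℝ :=
  Real.sqrt (v.ofLp ⬝ᵥ (A *ᵥ v.ofLp))

/-- The smallest (real) eigenvalue of a matrix. -/
def lambdaMin {d : ℕ} (A : Matrix (Fin d) (Fin d) ℝ) : ℝ := sInf (spectrum ℝ A)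

/-- The second largest absolute value `|λ₂|` among the eigenvalues of a (symmetric, doubly
stochastic) matrix `W`: the eigenvalues are listed with multiplicity, one copy of the
eigenvalue `1` is removed, and the largest remaining absolute value is taken. -/
def secondEig {N : ℕ} (W : Matrix (Fin N) (Fin N) ℝ) : ℝ :=
  sSup {b : ℝ | ∃ μ ∈ W.charpoly.roots.erase 1, b = |μ|}

/-! ### Accelerated consensus -/

/-- The scalar weights `c_h` of accelerated consensus: `c₀ = 1`, `c₁ = 1/l`,
`c_{h+1} = 2 c_h / l - c_{h-1}`, where `l = |λ₂|`. -/
def mixWeight (l : ℝ) : ℕ → ℝ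
  | 0 => 1
  | 1 => 1 / l
  | h + 2 => 2 * mixWeight l (h + 1) / l - mixWeight l h

/-- The vector of the values held by the agents after `h` rounds of accelerated consensus
started at `v`: `v₀ = v`, `v₁ = W v`, and
`v_{h+1} = (c_h / c_{h+1}) (2 / |λ₂|) W v_h - (c_{h-1} / c_{h+1}) v_{h-1}`. -/
def mix {N : ℕ} (W : Matrix (Fin N) (Fin N) ℝ) (v : Fin N → ℝ) : ℕ → Fin N → ℝ
  | 0 => v
  | 1 => W *ᵥ v
  | h + 2 =>
      (mixWeight (secondEig W) (h + 1) / mixWeight (secondEig W) (h + 2)) •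
          ((2 / secondEig W) • (W *ᵥ mix W v (h + 1)))
        - (mixWeight (secondEig W) h / mixWeight (secondEig W) (h + 2)) • mix W v h

/-! ### Problem data -/

/-- The data of a networked conservative linear bandit with `N` agents in dimension `d`,
together with the inputs of the algorithm. -/
structure Problem (N d : ℕ) where
  /-- horizon -/
  T : ℕ
  /-- weight matrix of the network -/
  W : Matrix (Fin N) (Fin N) ℝ
  /-- action set -/
  X : Set (EuclideanSpace ℝ (Fin d))
  /-- local reward parameters -/
  θ : Fin N → EuclideanSpace ℝ (Fin d)
  /-- baseline action at each round -/
  xb : ℕ → EuclideanSpace ℝ (Fin d)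
  /-- conservatism level -/
  α : ℝ
  /-- sub-Gaussian constant of the noise -/
  R : ℝ
  /-- bound on the local parameters -/
  S : ℝ
  /-- bound on the actions -/
  L : ℝ
  /-- lower bound on the baseline gap -/
  κl : ℝ
  /-- upper bound on the baseline gap -/
  κh : ℝ
  /-- lower bound on the baseline reward -/
  rl : ℝ
  /-- upper bound on the baseline reward -/
  rh : ℝ
  /-- regularization parameter -/
  lam : ℝ
  /-- confidence parameter -/
  δ : ℝ

namespace Problem

variable {N d : ℕ} (p : Problem N d)

/-- The global parameter: the average of the local ones. -/
def θglobal : EuclideanSpace ℝ (Fin d) := (N : ℝ)⁻¹ • ∑ i, p.θ i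

/-- Expected reward `r_{b,t}` of the baseline action at round `t`. -/
def rb (t : ℕ) : ℝ := ⟪p.xb t, p.θglobal⟫

/-- Number of communication rounds in episode `s`:
`⌈log (2 N s) / √(2 log (1 / |λ₂|))⌉`. -/
def q (s : ℕ) : ℕ :=
  ⌈Real.log (2 * N * s) / Real.sqrt (2 * Real.log (1 / secondEig p.W))⌉₊

/-- First round `t_s` of episode `s ≥ 1`; episode `k` occupies `1 + q k` rounds and `t₁ = 1`. -/
def startRound (s : ℕ) : ℕ := 1 + ∑ k ∈ Finset.Ico 1 s, (1 + p.q k)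

/-- Number `M` of episodes completed by time `T`: episode `s` occupies the
rounds `t_s, …, t_s + q s`. -/
def numEpisodes : ℕ :=
  ((Finset.Icc 1 p.T).filter fun s => p.startRound s + p.q s ≤ p.T).card

/-- The confidence radius `β_s`, computed with `δ / (2 N)` in place of `δ`. -/
def β (s : ℕ) : ℝ :=
  p.R / Real.sqrt N *
      Real.sqrt (d * Real.log ((1 + s * p.L ^ 2 / p.lam) / (p.δ / (2 * N))))
    + Real.sqrt p.lam * p.S + p.L / Real.sqrt p.lam

/-- The mixing weight `ρ = α r_l / (S + r_h)` of the conservative action. -/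
def ρ : ℝ := p.α * p.rl / (p.S + p.rh)

/-- The exploration threshold `(2 L β_{s-1} / (κ_l + α r_l))²` of episode `s`. -/
def threshold (s : ℕ) : ℝ := (2 * p.L * p.β (s - 1) / (p.κl + p.α * p.rl)) ^ 2

/-! In the next definitions `x k` is the action of episode `k ≥ 1` and `η i t` is the noise of
agent `i` at round `t`, along one trajectory. -/

variable (x : ℕ → EuclideanSpace ℝ (Fin d)) (η : Fin N → ℕ → ℝ)

/-- Reward observed by agent `i` at the first round of episode `k`. -/
def reward (k : ℕ) (i : Fin N) : ℝ := ⟪x k, p.θ i⟫ + η i (p.startRound k)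

/-- Estimate `y^i_k` of the network-average reward held by agent `i` after the `q k`
communication rounds of episode `k`. -/
def consensus (k : ℕ) (i : Fin N) : ℝ := mix p.W (p.reward x η k) (p.q k) i

/-- The Gram matrix `Σ_s = lam I + ∑_{k=1}^s x_k x_kᵀ`. -/
def gram (s : ℕ) : Matrix (Fin d) (Fin d) ℝ :=
  p.lam • (1 : Matrix (Fin d) (Fin d) ℝ)
    + ∑ k ∈ Finset.Icc 1 s, Matrix.vecMulVec (x k).ofLp (x k).ofLp

/-- The regularized least squares estimate `Σ_s⁻¹ ∑_{k=1}^s y^i_k x_k` of agent `i`. -/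
def estimate (s : ℕ) (i : Fin N) : EuclideanSpace ℝ (Fin d) :=
  WithLp.toLp 2 ((p.gram x s)⁻¹ *ᵥ (∑ k ∈ Finset.Icc 1 s, p.consensus x η k i • x k).ofLp)

/-- The confidence ellipsoid of agent `i` after `s` episodes. -/
def ellipsoid (s : ℕ) (i : Fin N) : Set (EuclideanSpace ℝ (Fin d)) :=
  {v | weightedNorm (p.gram x s) (v - p.estimate x η s i) ≤ p.β s}

/-- The estimated safe set that agent `i` uses in episode `s ≥ 1`: it is built from the
confidence ellipsoid available at that time (after `s - 1` episodes) and from the constraint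
`(1 - α) r_{b,t_s}` of the current round. -/
def safeSet (s : ℕ) (i : Fin N) : Set (EuclideanSpace ℝ (Fin d)) :=
  {z ∈ p.X | ∀ v ∈ p.ellipsoid x η (s - 1) i, (1 - p.α) * p.rb (p.startRound s) ≤ ⟪z, v⟫}

/-- `(z, v)` maximizes `(z, v) ↦ zᵀ v` over (safe set) × (confidence ellipsoid) of agent `i` in
episode `s`. -/
def IsUCB (s : ℕ) (i : Fin N) (z v : EuclideanSpace ℝ (Fin d)) : Prop :=
  z ∈ p.safeSet x η s i ∧ v ∈ p.ellipsoid x η (s - 1) i ∧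
    ∀ z' ∈ p.safeSet x η s i, ∀ v' ∈ p.ellipsoid x η (s - 1) i, ⟪z', v'⟫ ≤ ⟪z, v⟫

/-- The action-selection rule of episode `s`, when agent `i` has been selected and the
exploration direction is `u`: a UCB action if the safe set is nonempty and enough exploration
has occurred, the conservative action otherwise. -/
def FollowsRule (s : ℕ) (i : Fin N) (u : EuclideanSpace ℝ (Fin d)) : Prop :=
  ((p.safeSet x η s i).Nonempty ∧ p.threshold s ≤ lambdaMin (p.gram x (s - 1)) →
      ∃ v, p.IsUCB x η s i (x s) v) ∧
  (¬ ((p.safeSet x η s i).Nonempty ∧ p.threshold s ≤ lambdaMin (p.gram x (s - 1))) →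
      x s = (1 - p.ρ) • p.xb (p.startRound s) + p.ρ • u)

end Problem

/-! ### Standing assumptions -/

/-- The network: a connected undirected graph with a symmetric doubly stochastic weight matrix
supported exactly on the edges and the diagonal, with `1 > |λ₂| > 0`. -/
structure IsNetwork {N : ℕ} (G : SimpleGraph (Fin N)) (W : Matrix (Fin N) (Fin N) ℝ) : Prop where
  connected : G.Connected
  symm : W.IsSymm
  stochastic : W ∈ doublyStochastic ℝ (Fin N)
  support : ∀ i j, W i j = 0 ↔ ¬ (G.Adj i j ∨ j = i)
  secondEig_pos : 0 < secondEig W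
  secondEig_lt : secondEig W < 1

/-- Assumptions on the parameters, the actions and the baseline; `xstar` is an optimal action. -/
structure Admissible {N d : ℕ} (p : Problem N d) (xstar : EuclideanSpace ℝ (Fin d)) : Prop where
  α_pos : 0 < p.α
  α_lt : p.α < 1
  δ_pos : 0 < p.δ
  δ_lt : p.δ < 1
  lam_pos : 0 < p.lam
  R_nonneg : 0 ≤ p.R
  L_pos : 0 < p.L
  param_le : ∀ i, ‖p.θ i‖ ≤ p.S
  compact : IsCompact p.X
  convex : Convex ℝ p.X
  action_le : ∀ z ∈ p.X, ‖z‖ ≤ p.L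
  mean_mem : ∀ z ∈ p.X, ⟪z, p.θglobal⟫ ∈ Set.Icc (0 : ℝ) 1
  xstar_mem : xstar ∈ p.X
  xstar_max : ∀ z ∈ p.X, ⟪z, p.θglobal⟫ ≤ ⟪xstar, p.θglobal⟫
  baseline_mem : ∀ t ∈ Finset.Icc 1 p.T, p.xb t ∈ p.X
  κl_nonneg : 0 ≤ p.κl
  gap : ∀ t ∈ Finset.Icc 1 p.T,
    p.κl ≤ ⟪xstar, p.θglobal⟫ - p.rb t ∧ ⟪xstar, p.θglobal⟫ - p.rb t ≤ p.κh
  rl_pos : 0 < p.rl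
  baseline_reward : ∀ t ∈ Finset.Icc 1 p.T, p.rl ≤ p.rb t ∧ p.rb t ≤ p.rh

/-! ### Probability -/

section Probability

variable {Ω : Type*} {mΩ : MeasurableSpace Ω}

/-- `Y` has zero conditional mean and is conditionally `R`-sub-Gaussian given `m`. -/
def CondSubGaussian (P : Measure Ω) (m : MeasurableSpace Ω) (R : ℝ) (Y : Ω → ℝ) : Prop :=
  Integrable Y P ∧ P[Y | m] =ᵐ[P] 0 ∧
    ∀ c : ℝ, Integrable (fun ω => Real.exp (c * Y ω)) P ∧
      P[fun ω => Real.exp (c * Y ω) | m] ≤ᵐ[P] fun _ => Real.exp (c ^ 2 * R ^ 2 / 2)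

/-- The real random variables `Y i` are conditionally independent given `m`
(on an arbitrary probability space). -/
def CondIndepFamily (P : Measure Ω) (m : MeasurableSpace Ω) {N : ℕ} (Y : Fin N → Ω → ℝ) : Prop :=
  ∀ B : Fin N → Set ℝ, (∀ i, MeasurableSet (B i)) →
    P[(⋂ i, Y i ⁻¹' B i).indicator (fun _ => (1 : ℝ)) | m] =ᵐ[P]
      fun ω => ∏ i, (P[(Y i ⁻¹' B i).indicator (fun _ => (1 : ℝ)) | m]) ω

/-- The uniform distribution on the unit sphere of `ℝ^d`. -/
def uniformSphere (d : ℕ) : Measure (EuclideanSpace ℝ (Fin d)) :=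
  Measure.map Subtype.val
    (ProbabilityTheory.cond (volume : Measure (EuclideanSpace ℝ (Fin d))).toSphere Set.univ)

/-- The information available when the action of round `t` is played: everything up to round
`t - 1`, the agent selected at round `t`, and the exploration direction drawn at round `t`. -/
abbrev info {N d : ℕ} (ℱ : Filtration ℕ mΩ) (a : ℕ → Ω → Fin N)
    (ζ : ℕ → Ω → EuclideanSpace ℝ (Fin d)) (t : ℕ) : MeasurableSpace Ω :=
  ℱ (t - 1) ⊔ MeasurableSpace.comap (a t) ⊤
    ⊔ MeasurableSpace.comap (ζ t) inferInstance

/-- A run of the algorithm. `ℱ t` is the information up to round `t`, `a t` the agent selected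
and `ζ t` the exploration direction drawn at round `t`, `η i t` the noise of agent `i` at round
`t`, and `x s` the action of episode `s`. Only the rounds `1, …, T` and the completed episodes
`1, …, M` matter. -/
structure IsRun {N d : ℕ} (p : Problem N d) (P : Measure Ω) (ℱ : Filtration ℕ mΩ)
    (a : ℕ → Ω → Fin N) (ζ : ℕ → Ω → EuclideanSpace ℝ (Fin d)) (η : Fin N → ℕ → Ω → ℝ)
    (x : ℕ → Ω → EuclideanSpace ℝ (Fin d)) : Prop where
  agent_meas : ∀ t ∈ Finset.Icc 1 p.T, Measurable[ℱ t, ⊤] (a t)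
  agent_uniform : ∀ t ∈ Finset.Icc 1 p.T, ∀ i, P (a t ⁻¹' {i}) = (N : ENNReal)⁻¹
  agent_indep : ∀ t ∈ Finset.Icc 1 p.T,
    Indep (MeasurableSpace.comap (a t) ⊤) (ℱ (t - 1)) P
  dir_meas : ∀ t ∈ Finset.Icc 1 p.T, Measurable[ℱ t] (ζ t)
  dir_uniform : ∀ t ∈ Finset.Icc 1 p.T, Measure.map (ζ t) P = uniformSphere d
  dir_indep : ∀ t ∈ Finset.Icc 1 p.T,
    Indep (MeasurableSpace.comap (ζ t) inferInstance)
      (ℱ (t - 1) ⊔ MeasurableSpace.comap (a t) ⊤) P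
  noise_meas : ∀ t ∈ Finset.Icc 1 p.T, ∀ i, Measurable[ℱ t] (η i t)
  noise_subGaussian : ∀ t ∈ Finset.Icc 1 p.T, ∀ i,
    CondSubGaussian P (info ℱ a ζ t) p.R (η i t)
  noise_condIndep : ∀ t ∈ Finset.Icc 1 p.T,
    CondIndepFamily P (info ℱ a ζ t) (fun i => η i t)
  action_meas : ∀ s ∈ Finset.Icc 1 p.numEpisodes,
    Measurable[info ℱ a ζ (p.startRound s)] (x s)
  action_rule : ∀ s ∈ Finset.Icc 1 p.numEpisodes, ∀ ω,
    p.FollowsRule (fun k => x k ω) (fun i t => η i t ω) s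
      (a (p.startRound s) ω) (ζ (p.startRound s) ω)
  action_mem : ∀ s ∈ Finset.Icc 1 p.numEpisodes, ∀ᵐ ω ∂P, x s ω ∈ p.X
  reward_bounded : ∀ s ∈ Finset.Icc 1 p.numEpisodes, ∀ i, ∀ᵐ ω ∂P,
    |p.reward (fun k => x k ω) (fun i t => η i t ω) s i| ≤ 1

end Probability

end SafeBandit

end

noncomputable section

namespace SafeBandit

/-! ### Accelerated consensus -/

section Consensus

open Polynomial

/-! Accelerated consensus is Chebyshev iteration: `h` rounds apply `T_h(W/|λ₂|) / T_h(1/|λ₂|)` to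
the rewards. This fixes constants and divides every other spectral component by at least
`T_h(1/|λ₂|) = cosh (h * arcosh (1/|λ₂|))`. The length `q s` makes this divisor at least `N * s`, so
an agent's weights differ from `1/N` by errors whose squares sum to at most `1/(4 N s²)`
(`sum_sq_coeffError_le`), which is summable over episodes.

For the estimation error `u` put `Q = uᵀ Σ_s u`. The normal equations give `Q = λ ⟪u, θglobal⟫ - ∑
err_k ⟪u, x_k⟫`; bounding the right side by `β_s √Q` and dividing by `√Q` puts `θglobal` in the
ellipsoid (`weightedNorm_sub_estimate_le`). The noise part is handled uniformly in `s` and `u` by a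
self-normalized bound (`measure_exists_selfNormalized_le`), that is, Ville's inequality for a
determinant-times-exponential supermartingale.

The delicate point is to fit the consensus error into `β_s`, whose noise term is that of perfect
averaging (`θglobal_mem_ellipsoid`). If `λ ≤ L²`, the bounded rewards give a total squared error of
at most `1 ≤ L²/λ`, paid by `L/√λ`. If `λ > L²`, the error from the second episode on is split into
bias and noise. The bias fits into the slack `λ (S² - ‖θglobal‖²)`, since spread-out local
parameters have a short mean. The additional noise variance is absorbed by lowering the regularizer
to `λ - L²/4`, which `d ≥ 2` makes affordable in the determinant bound. The first episode is paid by
`L/√λ`.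

A union bound over agents, each failing with probability at most `δ/(2N)`, gives (i). Then (ii) is
deterministic: a large `λ_min` makes the ellipsoid so small that `xstar` is safe, compactness gives
maximizers, and `(xstar, θglobal)` is a feasible competitor. -/

lemma mixWeight_eq_eval_T (l : ℝ) (n : ℕ) :
    mixWeight l n = (Chebyshev.T ℝ n).eval (1 / l) := by
  induction n using Nat.twoStepInduction with
  | zero => simp [mixWeight]
  | one => simp [mixWeight]
  | more n h0 h1 =>
    have h := Chebyshev.T_add_two ℝ (n : ℤ)
    rw [mixWeight, h0, h1]
    push_cast
    rw [h]
    simp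
    ring

lemma mixWeight_eq_cosh {l : ℝ} (h0 : 0 < l) (h1 : l < 1) (n : ℕ) :
    mixWeight l n = Real.cosh (n * Real.arcosh (1 / l)) := by
  have h : (1 : ℝ) ≤ 1 / l := by rw [le_div_iff₀ h0]; linarith
  rw [mixWeight_eq_eval_T]
  conv_lhs => rw [← Real.cosh_arcosh h]
  rw [Chebyshev.T_real_cosh]
  simp

lemma mixWeight_pos {l : ℝ} (h0 : 0 < l) (h1 : l < 1) (n : ℕ) : 0 < mixWeight l n := by
  rw [mixWeight_eq_cosh h0 h1]
  exact Real.cosh_pos _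

lemma abs_eval_T_le_one {x : ℝ} (hx : |x| ≤ 1) (n : ℕ) :
    |(Chebyshev.T ℝ n).eval x| ≤ 1 := by
  rw [abs_le] at hx
  rw [← Real.cos_arccos hx.1 hx.2, Chebyshev.T_real_cos]
  exact Real.abs_cos_le_one _

/-- After `⌈log (2 K) / √(2 log (1 / l))⌉` rounds the mixing weight has reached `K`. -/
lemma le_mixWeight_ceil {l K : ℝ} (h0 : 0 < l) (h1 : l < 1) (hK : 0 < K) :
    K ≤ mixWeight l ⌈Real.log (2 * K) / Real.sqrt (2 * Real.log (1 / l))⌉₊ := by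
  set ψ := Real.sqrt (2 * Real.log (1 / l)) with hψ
  set n := ⌈Real.log (2 * K) / ψ⌉₊
  have hl : (1 : ℝ) < 1 / l := by rw [lt_div_iff₀ h0]; linarith
  have hlog : 0 < Real.log (1 / l) := Real.log_pos hl
  have hψ0 : 0 < ψ := Real.sqrt_pos.2 (by linarith)
  have hsq : ψ ^ 2 = 2 * Real.log (1 / l) := Real.sq_sqrt (by linarith)
  -- `ψ` is the number with `exp (ψ² / 2) = 1 / l`, so `cosh ψ ≤ exp (ψ² / 2)` places it below
  -- `arcosh (1 / l)`.
  have hcosh : Real.cosh ψ ≤ Real.cosh (Real.arcosh (1 / l)) := by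
    rw [Real.cosh_arcosh hl.le]
    refine (Real.cosh_le_exp_half_sq ψ).trans ?_
    rw [hsq, mul_div_cancel_left₀ _ two_ne_zero, Real.exp_log (by positivity)]
  have hle : ψ ≤ Real.arcosh (1 / l) := by
    have := Real.cosh_le_cosh.1 hcosh
    rwa [abs_of_pos hψ0, abs_of_nonneg (Real.arcosh_nonneg hl.le)] at this
  have hn : Real.log (2 * K) ≤ n * ψ := by
    have := Nat.le_ceil (Real.log (2 * K) / ψ)
    rwa [div_le_iff₀ hψ0] at this
  have hn' : Real.log (2 * K) ≤ n * Real.arcosh (1 / l) :=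
    hn.trans (mul_le_mul_of_nonneg_left hle (Nat.cast_nonneg _))
  have hexp : 2 * K ≤ Real.exp (n * Real.arcosh (1 / l)) := by
    rw [← Real.exp_log (show (0 : ℝ) < 2 * K by positivity)]
    exact Real.exp_le_exp.2 hn'
  -- The factor 2 inside the logarithm pays for `cosh y ≥ exp y / 2`.
  rw [mixWeight_eq_cosh h0 h1, Real.cosh_eq]
  have := Real.exp_pos (-(n * Real.arcosh (1 / l)))
  linarith

/-- The spectral multiplier of `n` rounds of accelerated consensus. -/
def mixMultiplier (l μ : ℝ) (n : ℕ) : ℝ :=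
  (Chebyshev.T ℝ n).eval (μ / l) / mixWeight l n

lemma mixMultiplier_one {l : ℝ} (h0 : 0 < l) (h1 : l < 1) (n : ℕ) : mixMultiplier l 1 n = 1 := by
  rw [mixMultiplier, ← mixWeight_eq_eval_T, div_self (mixWeight_pos h0 h1 n).ne']

lemma sq_mixMultiplier_le {l μ : ℝ} (h0 : 0 < l) (h1 : l < 1) (hμ : |μ| ≤ l) (n : ℕ) :
    mixMultiplier l μ n ^ 2 ≤ 1 / mixWeight l n ^ 2 := by
  have h : |μ / l| ≤ 1 := by rwa [abs_div, abs_of_pos h0, div_le_one h0]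
  have hT := abs_eval_T_le_one h n
  rw [mixMultiplier, div_pow]
  have := mixWeight_pos h0 h1 n
  gcongr
  exact (sq_le_one_iff_abs_le_one _).2 hT

/-! ### Spectral analysis of the consensus weights. -/

variable {N : ℕ} {W : Matrix (Fin N) (Fin N) ℝ}

/-- Tested against a left eigenvector, the vector recursion becomes the Chebyshev three-term
recurrence, normalized by the mixing weights. -/
lemma dotProduct_mix (h0 : 0 < secondEig W) (h1 : secondEig W < 1) {u : Fin N → ℝ} {μ : ℝ}
    (hu : u ᵥ* W = μ • u) (v : Fin N → ℝ) (n : ℕ) :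
    u ⬝ᵥ mix W v n = mixMultiplier (secondEig W) μ n * (u ⬝ᵥ v) := by
  have hW : ∀ z, u ⬝ᵥ (W *ᵥ z) = μ * (u ⬝ᵥ z) := fun z => by
    rw [Matrix.dotProduct_mulVec, hu, smul_dotProduct, smul_eq_mul]
  induction n using Nat.twoStepInduction with
  | zero => simp [mix, mixMultiplier, mixWeight]
  | one =>
    rw [mix, hW, mixMultiplier]
    simp only [Nat.cast_one, Chebyshev.T_one, eval_X, mixWeight]
    field_simp
  | more n i0 i1 =>
    have hc0 := (mixWeight_pos h0 h1 n).ne'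
    have hc1 := (mixWeight_pos h0 h1 (n + 1)).ne'
    have hc2 := (mixWeight_pos h0 h1 (n + 2)).ne'
    have hT := Chebyshev.T_add_two ℝ (n : ℤ)
    rw [mix, dotProduct_sub, dotProduct_smul, dotProduct_smul, dotProduct_smul, hW, i0, i1]
    simp only [smul_eq_mul, mixMultiplier]
    push_cast
    rw [hT]
    simp
    field_simp

lemma eigenvectorBasis_sum_mul {A : Matrix (Fin N) (Fin N) ℝ} (hA : A.IsHermitian) (i j : Fin N) :
    ∑ m, hA.eigenvectorBasis m i * hA.eigenvectorBasis m j = if i = j then 1 else 0 := by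
  have h := hA.eigenvectorBasis.sum_inner_mul_inner (EuclideanSpace.single i (1 : ℝ))
    (EuclideanSpace.single j (1 : ℝ))
  simpa [EuclideanSpace.inner_single_left, EuclideanSpace.inner_single_right, eq_comm] using h

lemma eigenvectorBasis_dot {A : Matrix (Fin N) (Fin N) ℝ} (hA : A.IsHermitian) (m k : Fin N) :
    ∑ i, hA.eigenvectorBasis m i * hA.eigenvectorBasis k i = if m = k then 1 else 0 := by
  have h := orthonormal_iff_ite.1 hA.eigenvectorBasis.orthonormal m k
  rw [← h, PiLp.inner_apply]
  refine Finset.sum_congr rfl fun i _ => ?_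
  simp [mul_comm]

lemma vecMul_eigenvectorBasis {A : Matrix (Fin N) (Fin N) ℝ} (hA : A.IsHermitian) (m : Fin N) :
    (hA.eigenvectorBasis m).ofLp ᵥ* A = hA.eigenvalues m • (hA.eigenvectorBasis m).ofLp := by
  have hT : Aᵀ = A := hA
  rw [← hA.mulVec_eigenvectorBasis m]
  have h := Matrix.vecMul_transpose A (hA.eigenvectorBasis m).ofLp
  rwa [hT] at h

/-- The weight that agent `i` gives to the initial value of agent `j` after `n` rounds. -/
def mixCoeff (hA : W.IsHermitian) (n : ℕ) (i j : Fin N) : ℝ :=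
  ∑ m, mixMultiplier (secondEig W) (hA.eigenvalues m) n *
    (hA.eigenvectorBasis m i * hA.eigenvectorBasis m j)

lemma mix_eq_sum (hA : W.IsHermitian) (h0 : 0 < secondEig W) (h1 : secondEig W < 1)
    (v : Fin N → ℝ) (n : ℕ) (i : Fin N) : mix W v n i = ∑ j, mixCoeff hA n i j * v j := by
  have hexp : mix W v n i
      = ∑ m, hA.eigenvectorBasis m i * ((hA.eigenvectorBasis m).ofLp ⬝ᵥ mix W v n) := by
    simp only [dotProduct, Finset.mul_sum]
    rw [Finset.sum_comm]
    simp only [← mul_assoc, ← Finset.sum_mul, eigenvectorBasis_sum_mul hA]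
    simp
  rw [hexp]
  simp only [dotProduct_mix h0 h1 (vecMul_eigenvectorBasis hA _), mixCoeff, Finset.sum_mul]
  rw [Finset.sum_comm]
  refine Finset.sum_congr rfl fun m _ => ?_
  simp only [dotProduct, Finset.mul_sum]
  refine Finset.sum_congr rfl fun j _ => ?_
  ring

lemma le_secondEig {μ : ℝ} (hμ : μ ∈ W.charpoly.roots.erase 1) : |μ| ≤ secondEig W := by
  refine le_csSup ?_ ⟨μ, hμ, rfl⟩
  have hfin : {b : ℝ | ∃ μ ∈ W.charpoly.roots.erase 1, b = |μ|}.Finite := by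
    refine ((W.charpoly.roots.erase 1).toFinset.finite_toSet.image fun μ => |μ|).subset ?_
    rintro b ⟨ν, hν, rfl⟩
    exact ⟨ν, by simpa using hν, rfl⟩
  exact hfin.bddAbove

variable {G : SimpleGraph (Fin N)}

lemma IsNetwork.isHermitian (hG : IsNetwork G W) : W.IsHermitian := by
  have h := hG.symm
  exact h

lemma IsNetwork.abs_eigenvalues_le (hG : IsNetwork G W) {m : Fin N}
    (hm : hG.isHermitian.eigenvalues m ≠ 1) :
    |hG.isHermitian.eigenvalues m| ≤ secondEig W := by
  refine le_secondEig ((Multiset.mem_erase_of_ne hm).2 ?_)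
  rw [hG.isHermitian.roots_charpoly_eq_eigenvalues]
  exact Multiset.mem_map_of_mem _ (Finset.mem_univ m)

/-- A repeated eigenvalue 1 would survive the removal of one copy and force `secondEig W ≥ 1`. -/
lemma IsNetwork.eq_of_eigenvalues_eq_one (hG : IsNetwork G W) {m k : Fin N}
    (hm : hG.isHermitian.eigenvalues m = 1) (hk : hG.isHermitian.eigenvalues k = 1) : m = k := by
  by_contra hne
  have h1 : (1 : ℝ) ∈ W.charpoly.roots.erase 1 := by
    rw [← Multiset.count_pos, Multiset.count_erase_self,
      hG.isHermitian.roots_charpoly_eq_eigenvalues, Multiset.count_map]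
    have hsub : ({m, k} : Finset (Fin N)).val ≤ Multiset.filter
        (fun a => (1 : ℝ) = ((RCLike.ofReal : ℝ → ℝ) ∘ hG.isHermitian.eigenvalues) a)
        Finset.univ.val := by
      rw [← Finset.filter_val]
      refine Finset.val_le_iff.2 fun j hj => ?_
      rcases Finset.mem_insert.1 hj with rfl | hj
      · simp [hm]
      · rw [Finset.mem_singleton.1 hj]; simp [hk]
    have hcard := Multiset.card_le_card hsub
    rw [Finset.card_val, Finset.card_pair hne] at hcard
    omega
  have := le_secondEig h1
  rw [abs_one] at this
  exact absurd hG.secondEig_lt (not_lt.2 this)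

lemma IsNetwork.mulVec_one (hG : IsNetwork G W) : W *ᵥ (1 : Fin N → ℝ) = 1 := by
  have h := (mem_doublyStochastic.1 hG.stochastic).2.1
  exact h

/-- The eigenvectors split: one is constant with eigenvalue `1`, and the others have eigenvalue at
most `|λ₂|` in absolute value and sum to zero. -/
lemma IsNetwork.exists_top (hG : IsNetwork G W) (hN : 0 < N) : ∃ k : Fin N,
    hG.isHermitian.eigenvalues k = 1 ∧
    (∀ m, m ≠ k → |hG.isHermitian.eigenvalues m| ≤ secondEig W) ∧
    (∀ m, m ≠ k → ∑ i, hG.isHermitian.eigenvectorBasis m i = 0) ∧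
    ∀ i j, hG.isHermitian.eigenvectorBasis k i * hG.isHermitian.eigenvectorBasis k j
      = (N : ℝ)⁻¹ := by
  set hA := hG.isHermitian
  -- `W` fixes the constant vector, so pairing it with an eigenvector `b` of eigenvalue `μ` gives
  -- `(1 - μ) ⟪b, 1⟫ = 0`.
  have horth : ∀ m, hA.eigenvalues m ≠ 1 → ∑ i, hA.eigenvectorBasis m i = 0 := by
    intro m hm
    have h := Matrix.dotProduct_mulVec (hA.eigenvectorBasis m).ofLp W 1
    rw [hG.mulVec_one, vecMul_eigenvectorBasis, smul_dotProduct, smul_eq_mul] at h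
    have h2 : (1 - hA.eigenvalues m) * ((hA.eigenvectorBasis m).ofLp ⬝ᵥ 1) = 0 := by linarith
    rcases mul_eq_zero.1 h2 with h3 | h3
    · exact absurd (by linarith) hm
    · simpa [dotProduct] using h3
  -- Expansion of the constant vector in the eigenbasis. Only eigenvalue 1 can contribute, which
  -- yields both the existence of `k` and the constancy of its eigenvector.
  have hone : ∀ i, ∑ m, (∑ j, hA.eigenvectorBasis m j) * hA.eigenvectorBasis m i = 1 := by
    intro i
    simp only [Finset.sum_mul]
    rw [Finset.sum_comm]
    simp [eigenvectorBasis_sum_mul hA]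
  have hex : ∃ k, hA.eigenvalues k = 1 := by
    by_contra! hne
    have := hone ⟨0, hN⟩
    simp [horth _ (hne _)] at this
  obtain ⟨k, hk⟩ := hex
  have hne : ∀ m, m ≠ k → hA.eigenvalues m ≠ 1 := fun m hm h =>
    hm (hG.eq_of_eigenvalues_eq_one h hk)
  refine ⟨k, hk, fun m hm => hG.abs_eigenvalues_le (hne m hm), fun m hm => horth m (hne m hm), ?_⟩
  set c := ∑ j, hA.eigenvectorBasis k j
  have hc : ∀ i, c * hA.eigenvectorBasis k i = 1 := by
    intro i
    have := hone i
    rwa [Finset.sum_eq_single k (fun m _ hm => by rw [horth m (hne m hm), zero_mul])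
      (by simp)] at this
  have hNc : c * c = N := by
    have : c * c = ∑ i, c * hA.eigenvectorBasis k i := by rw [← Finset.mul_sum]
    rw [this]
    simp [hc]
  intro i j
  have h1 : (c * hA.eigenvectorBasis k i) * (c * hA.eigenvectorBasis k j) = 1 := by
    rw [hc, hc, one_mul]
  have hN' : (N : ℝ) ≠ 0 := by positivity
  field_simp
  rw [← hNc]
  linarith

lemma IsNetwork.sum_mixCoeff (hG : IsNetwork G W) (n : ℕ) (i : Fin N) :
    ∑ j, mixCoeff hG.isHermitian n i j = 1 := by
  obtain ⟨k, hk, -, hsum, hJ⟩ := hG.exists_top i.pos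
  have hN' : (N : ℝ) ≠ 0 := by have := i.pos; positivity
  simp only [mixCoeff]
  rw [Finset.sum_comm]
  simp only [← Finset.mul_sum]
  rw [Finset.sum_eq_single k (fun m _ hm => by rw [hsum m hm]; simp) (by simp), hk,
    mixMultiplier_one hG.secondEig_pos hG.secondEig_lt, Finset.mul_sum]
  simp [hJ, hN']

/-- Subtracting `1/N` deletes the top eigenvector, and orthonormality turns the squared row norm
into a sum of squared multipliers weighted by `b m i ^ 2`. These weights have total mass `1 - 1/N`
off the top eigenvector, a factor used later to gain the constant `1/4`. -/
lemma IsNetwork.sum_sq_mixCoeff_sub (hG : IsNetwork G W) (n : ℕ) (i : Fin N) :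
    ∑ j, (mixCoeff hG.isHermitian n i j - (N : ℝ)⁻¹) ^ 2
      ≤ (1 - (N : ℝ)⁻¹) / mixWeight (secondEig W) n ^ 2 := by
  obtain ⟨k, hk, hle, hsum, hJ⟩ := hG.exists_top i.pos
  set hA := hG.isHermitian
  set f : Fin N → ℝ := fun m =>
    if m = k then 0 else mixMultiplier (secondEig W) (hA.eigenvalues m) n with hf
  set b := hA.eigenvectorBasis
  have hsub : ∀ j, mixCoeff hA n i j - (N : ℝ)⁻¹ = ∑ m, f m * (b m i * b m j) := by
    intro j
    rw [mixCoeff, ← Finset.add_sum_erase _ _ (Finset.mem_univ k),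
      ← Finset.add_sum_erase (Finset.univ : Finset (Fin N)) (fun m => f m * (b m i * b m j))
        (Finset.mem_univ k), hk,
      mixMultiplier_one hG.secondEig_pos hG.secondEig_lt, hJ i j]
    have : ∑ m ∈ Finset.univ.erase k, f m * (b m i * b m j)
        = ∑ m ∈ Finset.univ.erase k, mixMultiplier (secondEig W) (hA.eigenvalues m) n *
          (b m i * b m j) := by
      refine Finset.sum_congr rfl fun m hm => ?_
      rw [hf]
      simp [Finset.ne_of_mem_erase hm]
    rw [this]
    simp [hf, b]
  have hsq : ∑ j, (mixCoeff hA n i j - (N : ℝ)⁻¹) ^ 2 = ∑ m, f m ^ 2 * b m i ^ 2 := by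
    have h1 : ∀ j, (mixCoeff hA n i j - (N : ℝ)⁻¹) ^ 2
        = ∑ m, ∑ m', (f m * b m i) * (f m' * b m' i) * (b m j * b m' j) := by
      intro j
      rw [hsub, sq, Finset.sum_mul_sum]
      refine Finset.sum_congr rfl fun m _ => Finset.sum_congr rfl fun m' _ => ?_
      ring
    simp only [h1]
    rw [Finset.sum_comm]
    refine Finset.sum_congr rfl fun m _ => ?_
    rw [Finset.sum_comm]
    simp only [← Finset.mul_sum, b, eigenvectorBasis_dot hA]
    simp
    ring
  have hc := mixWeight_pos hG.secondEig_pos hG.secondEig_lt n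
  have hb : ∑ m ∈ Finset.univ.erase k, b m i ^ 2 = 1 - (N : ℝ)⁻¹ := by
    have h := eigenvectorBasis_sum_mul hA i i
    rw [← Finset.add_sum_erase _ _ (Finset.mem_univ k), hJ i i, if_pos rfl] at h
    simp only [← sq] at h
    linarith
  rw [hsq, ← hb, Finset.sum_div, ← Finset.add_sum_erase _ _ (Finset.mem_univ k)]
  have hk0 : f k = 0 := by simp [hf]
  rw [hk0]
  simp only [ne_eq, OfNat.ofNat_ne_zero, not_false_eq_true, zero_pow, zero_mul, zero_add]
  refine Finset.sum_le_sum fun m hm => ?_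
  have hne := Finset.ne_of_mem_erase hm
  have : f m ^ 2 ≤ 1 / mixWeight (secondEig W) n ^ 2 := by
    simp only [hf, if_neg hne]
    exact sq_mixMultiplier_le hG.secondEig_pos hG.secondEig_lt (hle m hne) n
  calc f m ^ 2 * b m i ^ 2 ≤ 1 / mixWeight (secondEig W) n ^ 2 * b m i ^ 2 := by gcongr
    _ = _ := by ring

/-- For `N ≤ 1` no eigenvalue is left after the removal, so `secondEig W` is the supremum of the
empty set, which is 0 by convention. -/
lemma IsNetwork.two_le (hG : IsNetwork G W) : 2 ≤ N := by
  by_contra! hN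
  have hN1 : N = 0 ∨ N = 1 := by omega
  have hdeg : W.charpoly.natDegree = N := by simp
  have hroots : ∀ μ, μ ∉ W.charpoly.roots.erase 1 := by
    rcases hN1 with rfl | rfl
    · intro μ hμ
      have h1 := Polynomial.card_roots' W.charpoly
      rw [hdeg] at h1
      have h2 : W.charpoly.roots = 0 := Multiset.card_eq_zero.1 (by omega)
      rw [h2] at hμ
      simp at hμ
    · intro μ hμ
      have h1 := hG.isHermitian.roots_charpoly_eq_eigenvalues
      obtain ⟨k, hk, -⟩ := hG.exists_top one_pos
      have h3 : W.charpoly.roots = {1} := by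
        rw [h1]
        have : (Finset.univ : Finset (Fin 1)).val = {k} := by
          rw [Subsingleton.elim k 0]; rfl
        rw [this]
        simp [hk]
      rw [h3] at hμ
      simp at hμ
  have : secondEig W = 0 := by
    rw [secondEig]
    have : {b : ℝ | ∃ μ ∈ W.charpoly.roots.erase 1, b = |μ|} = ∅ := by
      ext b
      simp only [Set.mem_ofPred_eq, Set.mem_empty_iff_false, iff_false]
      rintro ⟨μ, hμ, -⟩
      exact hroots μ hμ
    rw [this, Real.sSup_empty]
  exact absurd hG.secondEig_pos (by rw [this]; exact lt_irrefl _)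

end Consensus

/-! ### Rank one updates -/

section RankOne

variable {d : ℕ} {A : Matrix (Fin d) (Fin d) ℝ}

lemma posDef_add_vecMulVec (hA : A.PosDef) (x : Fin d → ℝ) :
    (A + Matrix.vecMulVec x x).PosDef :=
  hA.add_posSemidef (by simpa using Matrix.posSemidef_vecMulVec_self_star x)

lemma inv_quadratic_nonneg (hA : A.PosDef) (x : Fin d → ℝ) : 0 ≤ x ⬝ᵥ (A⁻¹ *ᵥ x) := by
  simpa using hA.inv.posSemidef.dotProduct_mulVec_nonneg x

lemma inv_quadratic_comm (hA : A.PosDef) (x y : Fin d → ℝ) :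
    x ⬝ᵥ (A⁻¹ *ᵥ y) = y ⬝ᵥ (A⁻¹ *ᵥ x) := by
  have hT : (A⁻¹)ᵀ = A⁻¹ := hA.inv.isHermitian
  rw [Matrix.dotProduct_mulVec, dotProduct_comm, ← Matrix.mulVec_transpose, hT]

lemma det_add_vecMulVec (hA : A.PosDef) (x : Fin d → ℝ) :
    (A + Matrix.vecMulVec x x).det = A.det * (1 + x ⬝ᵥ (A⁻¹ *ᵥ x)) := by
  have h := Matrix.det_add_replicateCol_mul_replicateRow (ι := Unit)
    (A := A) hA.det_pos.ne'.isUnit x x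
  rw [← Matrix.vecMulVec_eq] at h
  rw [h, Matrix.det_unique (n := Unit), Matrix.add_apply, Matrix.one_apply_eq, Matrix.mul_assoc,
    ← Matrix.replicateCol_mulVec, Matrix.replicateRow_mul_replicateCol_apply]

/-- The Sherman–Morrison formula for the inverse quadratic form. -/
lemma inv_quadratic_add_vecMulVec (hA : A.PosDef) (x S : Fin d → ℝ) (c : ℝ) :
    (S + c • x) ⬝ᵥ ((A + Matrix.vecMulVec x x)⁻¹ *ᵥ (S + c • x))
      = S ⬝ᵥ (A⁻¹ *ᵥ S) - (x ⬝ᵥ (A⁻¹ *ᵥ S)) ^ 2 / (1 + x ⬝ᵥ (A⁻¹ *ᵥ x))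
        + 2 * c * (x ⬝ᵥ (A⁻¹ *ᵥ S) / (1 + x ⬝ᵥ (A⁻¹ *ᵥ x)))
        + c ^ 2 * (x ⬝ᵥ (A⁻¹ *ᵥ x) / (1 + x ⬝ᵥ (A⁻¹ *ᵥ x))) := by
  set h := x ⬝ᵥ (A⁻¹ *ᵥ x) with hh
  have h0 : 0 ≤ h := inv_quadratic_nonneg hA x
  have hne : 1 + h ≠ 0 := by positivity
  have hinv : ∀ v, A *ᵥ (A⁻¹ *ᵥ v) = v := fun v => by
    rw [Matrix.mulVec_mulVec, Matrix.mul_nonsing_inv _ hA.det_pos.ne'.isUnit, Matrix.one_mulVec]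
  have hup : ∀ v, (A + Matrix.vecMulVec x x)⁻¹ *ᵥ v
      = A⁻¹ *ᵥ v - (x ⬝ᵥ (A⁻¹ *ᵥ v) / (1 + h)) • (A⁻¹ *ᵥ x) := by
    intro v
    set z := A⁻¹ *ᵥ v - (x ⬝ᵥ (A⁻¹ *ᵥ v) / (1 + h)) • (A⁻¹ *ᵥ x) with hz
    have hv : (A + Matrix.vecMulVec x x) *ᵥ z = v := by
      rw [Matrix.add_mulVec, Matrix.vecMulVec_mulVec, hz, Matrix.mulVec_sub, Matrix.mulVec_smul,
        hinv, hinv, dotProduct_sub, dotProduct_smul, ← hh]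
      ext i
      simp
      field_simp
      ring
    have hdet := (posDef_add_vecMulVec hA x).det_pos.ne'.isUnit
    conv_lhs => rw [← hv]
    rw [Matrix.mulVec_mulVec, Matrix.nonsing_inv_mul _ hdet, Matrix.one_mulVec]
  rw [hup]
  have hc := inv_quadratic_comm hA S x
  simp only [Matrix.mulVec_add, Matrix.mulVec_smul, dotProduct_add, add_dotProduct, dotProduct_sub,
    dotProduct_smul, smul_dotProduct, smul_eq_mul, hc, ← hh]
  field_simp
  ring

/-- Cauchy–Schwarz in the form `A` between `u` and `A⁻¹ S`, read off from the discriminant of `t ↦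
‖t u - A⁻¹ S‖_A²`. -/
lemma sq_dotProduct_le_inv_quadratic (hA : A.PosDef) (u S : Fin d → ℝ) :
    (u ⬝ᵥ S) ^ 2 ≤ (S ⬝ᵥ (A⁻¹ *ᵥ S)) * (u ⬝ᵥ (A *ᵥ u)) := by
  have hinv : A *ᵥ (A⁻¹ *ᵥ S) = S := by
    rw [Matrix.mulVec_mulVec, Matrix.mul_nonsing_inv _ hA.det_pos.ne'.isUnit, Matrix.one_mulVec]
  have hT : Aᵀ = A := hA.isHermitian
  have hAz : (A⁻¹ *ᵥ S) ⬝ᵥ (A *ᵥ u) = u ⬝ᵥ S := by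
    rw [Matrix.dotProduct_mulVec, ← Matrix.mulVec_transpose, hT, hinv, dotProduct_comm]
  have key : ∀ t : ℝ, 0 ≤ (u ⬝ᵥ (A *ᵥ u)) * (t * t) + (-2 * (u ⬝ᵥ S)) * t
      + S ⬝ᵥ (A⁻¹ *ᵥ S) := by
    intro t
    have h := hA.posSemidef.dotProduct_mulVec_nonneg (t • u - A⁻¹ *ᵥ S)
    simp only [star_trivial, Matrix.mulVec_sub, Matrix.mulVec_smul, hinv, dotProduct_sub,
      sub_dotProduct, dotProduct_smul, smul_dotProduct, smul_eq_mul, hAz] at h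
    rw [dotProduct_comm (A⁻¹ *ᵥ S) S] at h
    linarith
  have := discrim_le_zero key
  rw [discrim] at this
  nlinarith

/-- The inequality between arithmetic and geometric means of the eigenvalues, through `log t ≤ t -
1` at `t = λ_i / c`. -/
lemma det_le_pow_of_trace_le (hA : A.PosDef) {c : ℝ} (hc : 0 < c) (htr : A.trace ≤ d * c) :
    A.det ≤ c ^ d := by
  rw [hA.isHermitian.det_eq_prod_eigenvalues]
  rw [hA.isHermitian.trace_eq_sum_eigenvalues] at htr
  simp only [RCLike.ofReal_real_eq_id, id_eq] at htr ⊢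
  have hpos := hA.eigenvalues_pos
  rw [← Real.log_le_log_iff (Finset.prod_pos fun i _ => hpos i) (by positivity),
    Real.log_prod (fun i _ => (hpos i).ne'), Real.log_pow]
  have h1 : ∀ i, Real.log (hA.isHermitian.eigenvalues i)
      ≤ hA.isHermitian.eigenvalues i / c - 1 + Real.log c := by
    intro i
    have h := Real.log_le_sub_one_of_pos (div_pos (hpos i) hc)
    rw [Real.log_div (hpos i).ne' hc.ne'] at h
    linarith
  refine (Finset.sum_le_sum fun i _ => h1 i).trans ?_
  rw [Finset.sum_add_distrib, Finset.sum_sub_distrib, ← Finset.sum_div]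
  have : (∑ i, hA.isHermitian.eigenvalues i) / c ≤ d := by rwa [div_le_iff₀ hc]
  simp
  linarith

end RankOne

/-! ### Measurability of matrix functions -/

section MatrixMeasurable

variable {Ω : Type*} [MeasurableSpace Ω] {d : ℕ} {A : Ω → Matrix (Fin d) (Fin d) ℝ}

lemma measurable_det (hA : ∀ i j, Measurable fun ω => A ω i j) :
    Measurable fun ω => (A ω).det := by
  simp only [Matrix.det_apply]
  refine Finset.measurable_sum _ fun σ _ => ?_
  exact (Finset.measurable_prod _ fun i _ => hA _ _).const_smul _

lemma measurable_inv_apply (hA : ∀ i j, Measurable fun ω => A ω i j) (i j : Fin d) :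
    Measurable fun ω => (A ω)⁻¹ i j := by
  simp only [Matrix.inv_def, Matrix.smul_apply, Ring.inverse_eq_inv', Matrix.adjugate_apply,
    smul_eq_mul]
  refine (measurable_det hA).inv.mul (measurable_det fun k l => ?_)
  simp only [Matrix.updateRow_apply]
  split_ifs
  · exact measurable_const
  · exact hA _ _

lemma measurable_inv_quadratic (hA : ∀ i j, Measurable fun ω => A ω i j) {u v : Ω → Fin d → ℝ}
    (hu : Measurable u) (hv : Measurable v) :
    Measurable fun ω => u ω ⬝ᵥ ((A ω)⁻¹ *ᵥ v ω) := by
  simp only [dotProduct, Matrix.mulVec]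
  refine Finset.measurable_sum _ fun i _ => (measurable_pi_iff.1 hu i).mul ?_
  exact Finset.measurable_sum _ fun j _ =>
    (measurable_inv_apply hA i j).mul (measurable_pi_iff.1 hv j)

end MatrixMeasurable

/-! ### A maximal inequality for nonnegative supermartingales -/

/-- Ville's inequality, by optional stopping at the first passage above `c`: the induction keeps `c
* P(passage by time s)` plus the integral of `Z s` off that event below 1. The family `m` need not
be increasing; it suffices that `m s` measures `Z 0, …, Z s`. -/
lemma mul_measure_exists_le_le_one {Ω : Type*} {mΩ : MeasurableSpace Ω} {P : Measure Ω}
    {M : ℕ} {m : ℕ → MeasurableSpace Ω} {Z : ℕ → Ω → ENNReal}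
    (hZ : ∀ k ≤ M, Measurable (Z k)) (hZm : ∀ k s, k ≤ s → s < M → Measurable[m s] (Z k))
    (hstep : ∀ s < M, ∀ A, MeasurableSet[m s] A → ∫⁻ ω in A, Z (s + 1) ω ∂P ≤ ∫⁻ ω in A, Z s ω ∂P)
    (h0 : ∫⁻ ω, Z 0 ω ∂P ≤ 1) (c : ENNReal) :
    c * P {ω | ∃ k ≤ M, c ≤ Z k ω} ≤ 1 := by
  have hmarkov : ∀ k ≤ M, ∀ B, MeasurableSet B →
      c * P (B ∩ {ω | c ≤ Z k ω}) ≤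
        ∫⁻ ω in B ∩ {ω | c ≤ Z k ω}, Z k ω ∂P := by
    intro k hk B hB
    have hs : MeasurableSet (B ∩ {ω | c ≤ Z k ω}) :=
      hB.inter (measurableSet_le measurable_const (hZ k hk))
    rw [← setLIntegral_const]
    exact setLIntegral_mono' hs fun ω hω => hω.2
  have hset : ∀ s ≤ M, MeasurableSet {ω | ∃ k ≤ s, c ≤ Z k ω} := by
    intro s hs
    have : {ω | ∃ k ≤ s, c ≤ Z k ω} = ⋃ k ∈ Finset.range (s + 1), {ω | c ≤ Z k ω} := by
      ext ω; simp
    rw [this]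
    refine Finset.measurableSet_biUnion _ fun k hk => measurableSet_le measurable_const (hZ k ?_)
    have := Finset.mem_range.1 hk
    omega
  have key : ∀ s ≤ M, c * P {ω | ∃ k ≤ s, c ≤ Z k ω}
      + ∫⁻ ω in {ω | ∃ k ≤ s, c ≤ Z k ω}ᶜ, Z s ω ∂P ≤ 1 := by
    intro s
    induction s with
    | zero =>
      intro hs
      have hA : {ω | ∃ k ≤ 0, c ≤ Z k ω} = Set.univ ∩ {ω | c ≤ Z 0 ω} := by ext ω; simp
      have hme := hset 0 hs
      have h := hmarkov 0 hs Set.univ MeasurableSet.univ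
      rw [← hA] at h
      calc _ ≤ ∫⁻ ω in {ω | ∃ k ≤ 0, c ≤ Z k ω}, Z 0 ω ∂P
            + ∫⁻ ω in {ω | ∃ k ≤ 0, c ≤ Z k ω}ᶜ, Z 0 ω ∂P := by gcongr
        _ = ∫⁻ ω, Z 0 ω ∂P := lintegral_add_compl _ hme
        _ ≤ 1 := h0
    | succ s ih =>
      intro hs
      have hsM : s < M := hs
      set A := {ω | ∃ k ≤ s, c ≤ Z k ω} with hAdef
      have hA := hset s hsM.le
      -- First passage exactly at time `s + 1`.
      set B := Aᶜ ∩ {ω | c ≤ Z (s + 1) ω} with hB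
      have hBm : MeasurableSet B := hA.compl.inter (measurableSet_le measurable_const (hZ _ hs))
      have hun : {ω | ∃ k ≤ s + 1, c ≤ Z k ω} = A ∪ B := by
        ext ω
        simp only [hB, hAdef, Set.mem_union, Set.mem_inter_iff, Set.mem_compl_iff,
          Set.mem_ofPred_eq]
        constructor
        · rintro ⟨k, hk, hkc⟩
          rcases Nat.le_succ_iff.1 hk with hk | rfl
          · exact Or.inl ⟨k, hk, hkc⟩
          · by_cases h : ∃ k ≤ s, c ≤ Z k ω
            · exact Or.inl h
            · exact Or.inr ⟨h, hkc⟩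
        · rintro (⟨k, hk, hkc⟩ | ⟨-, h⟩)
          · exact ⟨k, hk.trans (Nat.le_succ s), hkc⟩
          · exact ⟨s + 1, le_rfl, h⟩
      have hAm : MeasurableSet[m s] A := by
        have : A = ⋃ k ∈ Finset.range (s + 1), {ω | c ≤ Z k ω} := by
          ext ω; simp [hAdef]
        rw [this]
        refine Finset.measurableSet_biUnion _ fun k hk => ?_
        have hk' := Finset.mem_range.1 hk
        exact hZm k s (by omega) hsM measurableSet_Ici
      have hcompl : (A ∪ B)ᶜ = Aᶜ \ B := by
        rw [Set.compl_union, Set.sdiff_eq]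
      rw [hun, hcompl]
      have hsplit : ∫⁻ ω in B, Z (s + 1) ω ∂P + ∫⁻ ω in Aᶜ \ B, Z (s + 1) ω ∂P
          = ∫⁻ ω in Aᶜ, Z (s + 1) ω ∂P := by
        have h := lintegral_inter_add_sdiff (μ := P) (fun ω => Z (s + 1) ω) Aᶜ hBm
        rwa [Set.inter_eq_self_of_subset_right (Set.inter_subset_left)] at h
      calc c * P (A ∪ B) + ∫⁻ ω in Aᶜ \ B, Z (s + 1) ω ∂P
          ≤ c * (P A + P B) + ∫⁻ ω in Aᶜ \ B, Z (s + 1) ω ∂P := by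
            gcongr; exact measure_union_le _ _
        _ = c * P A + (c * P B + ∫⁻ ω in Aᶜ \ B, Z (s + 1) ω ∂P) := by rw [mul_add, add_assoc]
        _ ≤ c * P A + (∫⁻ ω in B, Z (s + 1) ω ∂P + ∫⁻ ω in Aᶜ \ B, Z (s + 1) ω ∂P) := by
            gcongr
            exact hmarkov (s + 1) hs Aᶜ hA.compl
        _ = c * P A + ∫⁻ ω in Aᶜ, Z (s + 1) ω ∂P := by rw [hsplit]
        _ ≤ c * P A + ∫⁻ ω in Aᶜ, Z s ω ∂P := by
            exact add_le_add le_rfl (hstep s hsM _ (@MeasurableSet.compl _ _ (m s) hAm))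
        _ ≤ 1 := ih hsM.le
  exact le_self_add.trans (key M le_rfl)

/-! ### A self-normalized tail bound -/

/-- `exp (C ξ - C² / 2)` has conditional mean at most one given `m`, for every `m`-measurable
coefficient `C`. -/
def IsStandardSubGaussian {Ω : Type*} {mΩ : MeasurableSpace Ω} (P : Measure Ω)
    (m : MeasurableSpace Ω) (ξ : Ω → ℝ) : Prop :=
  ∀ (C : Ω → ℝ) (Y : Ω → ENNReal), Measurable[m] C → Measurable[m] Y →
    ∫⁻ ω, Y ω * ENNReal.ofReal (Real.exp (C ω * ξ ω - C ω ^ 2 / 2)) ∂P ≤ ∫⁻ ω, Y ω ∂P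

lemma lintegral_exp_gaussian (t : ℝ) :
    ∫⁻ g, ENNReal.ofReal (Real.exp (t * g)) ∂(gaussianReal 0 1)
      = ENNReal.ofReal (Real.exp (t ^ 2 / 2)) := by
  rw [← ofReal_integral_eq_lintegral_ofReal (integrable_exp_mul_gaussianReal t)
    (ae_of_all _ fun _ => (Real.exp_pos _).le)]
  have h := mgf_gaussianReal (p := gaussianReal 0 1) (X := id) (μ := 0) (v := 1) (by simp) t
  simp only [mgf, id] at h
  rw [h]
  simp

/-- Completing the square: `1 - h / (1 + h) = 1 / (1 + h)`, so the integrand times the standard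
density is a constant multiple of the normal density with mean `b r (1 + h)` and variance `1 + h`.
-/
lemma lintegral_exp_quadratic_gaussian {h : ℝ} (h0 : 0 ≤ h) (b : ℝ) :
    ∫⁻ g, ENNReal.ofReal (Real.exp ((b + Real.sqrt (h / (1 + h)) * g) ^ 2 / 2)) ∂(gaussianReal 0 1)
      = ENNReal.ofReal (Real.sqrt (1 + h) * Real.exp (b ^ 2 * (1 + h) / 2)) := by
  set r := Real.sqrt (h / (1 + h)) with hr
  have h1 : 0 < 1 + h := by positivity
  have hr2 : r ^ 2 = h / (1 + h) := Real.sq_sqrt (by positivity)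
  have hv : Real.toNNReal (1 + h) ≠ 0 := (Real.toNNReal_pos.2 h1).ne'
  rw [gaussianReal_of_var_ne_zero 0 one_ne_zero,
    lintegral_withDensity_eq_lintegral_mul _ (measurable_gaussianPDF 0 1) (by fun_prop)]
  have hpt : ∀ g : ℝ, (gaussianPDF 0 1 * fun g => ENNReal.ofReal (Real.exp ((b + r * g) ^ 2 / 2))) g
      = ENNReal.ofReal (Real.sqrt (1 + h) * Real.exp (b ^ 2 * (1 + h) / 2))
        * gaussianPDF (b * r * (1 + h)) (Real.toNNReal (1 + h)) g := by
    intro g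
    simp only [Pi.mul_apply, gaussianPDF]
    rw [← ENNReal.ofReal_mul (gaussianPDFReal_nonneg _ _ _),
      ← ENNReal.ofReal_mul (by positivity)]
    congr 1
    simp only [gaussianPDFReal, NNReal.coe_one, Real.coe_toNNReal _ h1.le]
    have hs : Real.sqrt (2 * Real.pi * (1 + h)) = Real.sqrt (2 * Real.pi) * Real.sqrt (1 + h) :=
      Real.sqrt_mul (by positivity) _
    have hs1 : Real.sqrt (1 + h) ≠ 0 := (Real.sqrt_pos.2 h1).ne'
    have hs2 : Real.sqrt (2 * Real.pi) ≠ 0 := by positivity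
    rw [hs, mul_one, mul_assoc, ← Real.exp_add]
    have he : -(g - 0) ^ 2 / (2 * 1) + (b + r * g) ^ 2 / 2
        = b ^ 2 * (1 + h) / 2 + -(g - b * r * (1 + h)) ^ 2 / (2 * (1 + h)) := by
      have e1 : (b + r * g) ^ 2 = b ^ 2 + 2 * b * r * g + (h / (1 + h)) * g ^ 2 := by
        rw [← hr2]; ring
      have e2 : (g - b * r * (1 + h)) ^ 2
          = g ^ 2 - 2 * g * b * r * (1 + h) + b ^ 2 * (h / (1 + h)) * (1 + h) ^ 2 := by
        rw [← hr2]; ring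
      rw [e1, e2]
      field_simp
      ring
    rw [he, Real.exp_add]
    field_simp
  rw [lintegral_congr hpt, lintegral_const_mul _ (measurable_gaussianPDF _ _),
    lintegral_gaussianPDF_eq_one _ hv, mul_one]

/-- The exponential moment of a quadratic function of a conditionally sub-Gaussian variable. -/
lemma IsStandardSubGaussian.lintegral_exp_quadratic_le {Ω : Type*} {m mΩ : MeasurableSpace Ω}
    {P : Measure Ω} [SFinite P] (hm : m ≤ mΩ) {ξ : Ω → ℝ}
    (hξ : Measurable ξ) (hsg : IsStandardSubGaussian P m ξ) {Y : Ω → ENNReal} {b h : Ω → ℝ}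
    (hY : Measurable[m] Y) (hb : Measurable[m] b) (hh : Measurable[m] h) (h0 : ∀ ω, 0 ≤ h ω) :
    ∫⁻ ω, Y ω * ENNReal.ofReal
        (Real.exp (b ω * ξ ω + h ω / (1 + h ω) * ξ ω ^ 2 / 2)) ∂P
      ≤ ∫⁻ ω, Y ω * ENNReal.ofReal
        (Real.sqrt (1 + h ω) * Real.exp (b ω ^ 2 * (1 + h ω) / 2)) ∂P := by
  have hY' := hY.mono hm le_rfl
  have hb' := hb.mono hm le_rfl
  have hh' := hh.mono hm le_rfl
  -- The quadratic term is linearized: `exp (r² ξ² / 2)` is the average of `exp (r g ξ)` over a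
  -- standard Gaussian `g`. After exchanging integrals, the hypothesis applies for each fixed `g`
  -- with coefficient `b + r g`.
  set r : Ω → ℝ := fun ω => Real.sqrt (h ω / (1 + h ω)) with hr
  have hrm : Measurable[m] r := (hh.div (measurable_const.add hh)).sqrt
  have hrm' := hrm.mono hm le_rfl
  have hleft : ∀ ω, Y ω * ENNReal.ofReal
        (Real.exp (b ω * ξ ω + h ω / (1 + h ω) * ξ ω ^ 2 / 2))
      = ∫⁻ g, Y ω * ENNReal.ofReal (Real.exp ((b ω + r ω * g) * ξ ω)) ∂(gaussianReal 0 1) := by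
    intro ω
    rw [lintegral_const_mul _ (by fun_prop)]
    congr 1
    have : ∀ g : ℝ, ENNReal.ofReal (Real.exp ((b ω + r ω * g) * ξ ω))
        = ENNReal.ofReal (Real.exp (b ω * ξ ω))
          * ENNReal.ofReal (Real.exp ((r ω * ξ ω) * g)) := by
      intro g
      rw [← ENNReal.ofReal_mul (Real.exp_pos _).le, ← Real.exp_add]
      ring_nf
    simp only [this]
    rw [lintegral_const_mul _ (by fun_prop), lintegral_exp_gaussian,
      ← ENNReal.ofReal_mul (Real.exp_pos _).le, ← Real.exp_add, mul_pow, hr,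
      Real.sq_sqrt (div_nonneg (h0 ω) (by have := h0 ω; positivity))]
  have hright : ∀ ω, Y ω * ENNReal.ofReal
        (Real.sqrt (1 + h ω) * Real.exp (b ω ^ 2 * (1 + h ω) / 2))
      = ∫⁻ g, Y ω * ENNReal.ofReal (Real.exp ((b ω + r ω * g) ^ 2 / 2)) ∂(gaussianReal 0 1) := by
    intro ω
    rw [lintegral_const_mul _ (by fun_prop), hr, lintegral_exp_quadratic_gaussian (h0 ω)]
  simp only [hleft, hright]
  have hm1 : AEMeasurable (Function.uncurry fun (ω : Ω) (g : ℝ) => Y ω * ENNReal.ofReal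
      (Real.exp ((b ω + r ω * g) * ξ ω))) (P.prod (gaussianReal 0 1)) := by
    simp only [Function.uncurry_def]
    exact Measurable.aemeasurable (by fun_prop)
  have hm2 : AEMeasurable (Function.uncurry fun (ω : Ω) (g : ℝ) => Y ω * ENNReal.ofReal
      (Real.exp ((b ω + r ω * g) ^ 2 / 2))) (P.prod (gaussianReal 0 1)) := by
    simp only [Function.uncurry_def]
    exact Measurable.aemeasurable (by fun_prop)
  rw [lintegral_lintegral_swap hm1, lintegral_lintegral_swap hm2]
  refine lintegral_mono fun g => ?_
  have hC : Measurable[m] fun ω => b ω + r ω * g := hb.add (hrm.mul measurable_const)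
  -- The test weight carries `exp (C² / 2)`, which cancels the normalization built into
  -- `IsStandardSubGaussian`.
  have hYC : Measurable[m] fun ω => Y ω * ENNReal.ofReal (Real.exp ((b ω + r ω * g) ^ 2 / 2)) :=
    hY.mul ((hC.pow_const 2).div_const 2).exp.ennreal_ofReal
  refine le_of_eq_of_le (lintegral_congr fun ω => ?_) (hsg _ _ hC hYC)
  rw [mul_assoc, ← ENNReal.ofReal_mul (Real.exp_pos _).le, ← Real.exp_add]
  ring_nf

section SelfNormalized

variable {Ω : Type*} {d : ℕ}

/-- The regularized Gram matrix `c I + ∑_{k < s} x_k x_kᵀ`. -/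
def regGram (c : ℝ) (x : ℕ → Fin d → ℝ) (s : ℕ) : Matrix (Fin d) (Fin d) ℝ :=
  c • (1 : Matrix (Fin d) (Fin d) ℝ) + ∑ k ∈ Finset.range s, Matrix.vecMulVec (x k) (x k)

lemma regGram_succ (c : ℝ) (x : ℕ → Fin d → ℝ) (s : ℕ) :
    regGram c x (s + 1) = regGram c x s + Matrix.vecMulVec (x s) (x s) := by
  rw [regGram, Finset.sum_range_succ, ← add_assoc, ← regGram]

lemma regGram_posDef {c : ℝ} (hc : 0 < c) (x : ℕ → Fin d → ℝ) (s : ℕ) :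
    (regGram c x s).PosDef := by
  induction s with
  | zero => simpa [regGram] using Matrix.PosDef.one.smul hc
  | succ s ih => rw [regGram_succ]; exact posDef_add_vecMulVec ih _

lemma regGram_quadratic (c : ℝ) (x : ℕ → Fin d → ℝ) (s : ℕ) (u : Fin d → ℝ) :
    u ⬝ᵥ (regGram c x s *ᵥ u) = c * (u ⬝ᵥ u) + ∑ k ∈ Finset.range s, (u ⬝ᵥ x k) ^ 2 := by
  induction s with
  | zero => simp [regGram, Matrix.smul_mulVec]
  | succ s ih =>
    rw [regGram_succ, Matrix.add_mulVec, dotProduct_add, ih, Finset.sum_range_succ,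
      Matrix.vecMulVec_mulVec, dotProduct_comm (x s) u]
    simp [dotProduct_smul]
    ring

lemma regGram_trace (c : ℝ) (x : ℕ → Fin d → ℝ) (s : ℕ) :
    (regGram c x s).trace = d * c + ∑ k ∈ Finset.range s, x k ⬝ᵥ x k := by
  simp [regGram, Matrix.trace_sum, Matrix.trace_vecMulVec, mul_comm]

/-- The vector `∑_{k < s} ξ_k x_k`. -/
def noiseSum (x : ℕ → Fin d → ℝ) (ξ : ℕ → ℝ) (s : ℕ) : Fin d → ℝ :=
  ∑ k ∈ Finset.range s, ξ k • x k

/-- The nonnegative supermartingale behind the self-normalized bound. -/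
def mixture (c : ℝ) (x : ℕ → Fin d → ℝ) (ξ : ℕ → ℝ) (s : ℕ) : ℝ :=
  Real.sqrt (c ^ d / (regGram c x s).det)
    * Real.exp (noiseSum x ξ s ⬝ᵥ ((regGram c x s)⁻¹ *ᵥ noiseSum x ξ s) / 2)

/-- The determinant and Sherman–Morrison formulas isolate the new noise value in one factor, the
exponential of a quadratic in `ξ s` of the shape treated by
`IsStandardSubGaussian.lintegral_exp_quadratic_le`. -/
lemma mixture_succ {c : ℝ} (hc : 0 < c) (x : ℕ → Fin d → ℝ) (ξ : ℕ → ℝ) (s : ℕ) :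
    let g := x s ⬝ᵥ ((regGram c x s)⁻¹ *ᵥ noiseSum x ξ s)
    let h := x s ⬝ᵥ ((regGram c x s)⁻¹ *ᵥ x s)
    mixture c x ξ (s + 1) = mixture c x ξ s
      * (Real.exp (-(g ^ 2 / (1 + h)) / 2) / Real.sqrt (1 + h))
      * Real.exp (g / (1 + h) * ξ s + h / (1 + h) * ξ s ^ 2 / 2) := by
  intro g h
  have hA := regGram_posDef hc x s
  have h0 : 0 ≤ h := inv_quadratic_nonneg hA _
  have hS : noiseSum x ξ (s + 1) = noiseSum x ξ s + ξ s • x s := by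
    rw [noiseSum, Finset.sum_range_succ, ← noiseSum]
  rw [mixture, hS, regGram_succ, inv_quadratic_add_vecMulVec hA, det_add_vecMulVec hA, mixture,
    ← div_div, Real.sqrt_div (div_nonneg (by positivity) hA.det_pos.le)]
  change _ / Real.sqrt (1 + h) * Real.exp ((_ - g ^ 2 / (1 + h) + 2 * ξ s * (g / (1 + h))
    + ξ s ^ 2 * (h / (1 + h))) / 2) = _
  have : ∀ q : ℝ, (q - g ^ 2 / (1 + h) + 2 * ξ s * (g / (1 + h)) + ξ s ^ 2 * (h / (1 + h))) / 2
      = q / 2 + -(g ^ 2 / (1 + h)) / 2 + (g / (1 + h) * ξ s + h / (1 + h) * ξ s ^ 2 / 2) := by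
    intro q; ring
  rw [this, Real.exp_add, Real.exp_add]
  ring

lemma measurable_regGram_apply {m : MeasurableSpace Ω} {x : ℕ → Ω → Fin d → ℝ} {s : ℕ}
    (hx : ∀ k < s, Measurable (x k)) (c : ℝ) (i j : Fin d) :
    Measurable fun ω => regGram c (fun k => x k ω) s i j := by
  simp only [regGram, Matrix.add_apply, Matrix.sum_apply, Matrix.vecMulVec_apply]
  refine measurable_const.add (Finset.measurable_sum _ fun k hk => ?_)
  have := measurable_pi_iff.1 (hx k (Finset.mem_range.1 hk))
  exact (this i).mul (this j)

lemma measurable_noiseSum {m : MeasurableSpace Ω} {x : ℕ → Ω → Fin d → ℝ} {ξ : ℕ → Ω → ℝ} {s : ℕ}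
    (hx : ∀ k < s, Measurable (x k)) (hξ : ∀ k < s, Measurable (ξ k)) :
    Measurable fun ω => noiseSum (fun k => x k ω) (fun k => ξ k ω) s := by
  simp only [noiseSum]
  refine Finset.measurable_sum _ fun k hk => ?_
  exact (hξ k (Finset.mem_range.1 hk)).smul (hx k (Finset.mem_range.1 hk))

lemma measurable_mixture {m : MeasurableSpace Ω} {x : ℕ → Ω → Fin d → ℝ} {ξ : ℕ → Ω → ℝ} {s : ℕ}
    (hx : ∀ k < s, Measurable (x k)) (hξ : ∀ k < s, Measurable (ξ k)) (c : ℝ) :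
    Measurable fun ω => mixture c (fun k => x k ω) (fun k => ξ k ω) s := by
  have hG := measurable_regGram_apply hx c
  have hS := measurable_noiseSum hx hξ
  exact (measurable_const.div (measurable_det hG)).sqrt.mul
    ((measurable_inv_quadratic hG hS hS).div_const 2).exp

/-- Self-normalized bound: with probability at least `1 - δ`, simultaneously for all `s ≤ M`,
`‖∑_{k<s} ξ_k x_k‖²` in the norm of the inverse regularized Gram matrix is less than
`2 log (1/δ) + log (det V_s / cᵈ)`. -/
theorem measure_exists_selfNormalized_le {mΩ : MeasurableSpace Ω} {P : Measure Ω}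
    [IsProbabilityMeasure P] {M : ℕ} {m : ℕ → MeasurableSpace Ω} (hm : ∀ k < M, m k ≤ mΩ)
    {x : ℕ → Ω → Fin d → ℝ} {ξ : ℕ → Ω → ℝ} (hx : ∀ j k, j ≤ k → k < M → Measurable[m k] (x j))
    (hξ : ∀ j k, j < k → k < M → Measurable[m k] (ξ j)) (hξ' : ∀ k < M, Measurable (ξ k))
    (hsg : ∀ k < M, IsStandardSubGaussian P (m k) (ξ k)) {c δ : ℝ} (hc : 0 < c) (hδ : 0 < δ) :
    P {ω | ∃ s ≤ M, 2 * Real.log (1 / δ)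
        + Real.log ((regGram c (fun k => x k ω) s).det / c ^ d)
        ≤ noiseSum (fun k => x k ω) (fun k => ξ k ω) s ⬝ᵥ
          ((regGram c (fun k => x k ω) s)⁻¹ *ᵥ noiseSum (fun k => x k ω) (fun k => ξ k ω) s)}
      ≤ ENNReal.ofReal δ := by
  set Z : ℕ → Ω → ENNReal := fun s ω =>
    ENNReal.ofReal (mixture c (fun k => x k ω) (fun k => ξ k ω) s) with hZ
  have hZm : ∀ k s, k ≤ s → s < M → Measurable[m s] (Z k) := by
    intro k s hks hs
    exact (measurable_mixture (fun j hj => hx j s (by omega) hs)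
      (fun j hj => hξ j s (by omega) hs) c).ennreal_ofReal
  have hZ' : ∀ k ≤ M, Measurable (Z k) := by
    intro k hk
    exact (measurable_mixture (fun j hj => (hx j j le_rfl (by omega)).mono (hm j (by omega)) le_rfl)
      (fun j hj => hξ' j (by omega)) c).ennreal_ofReal
  have hstep : ∀ s < M, ∀ A, MeasurableSet[m s] A →
      ∫⁻ ω in A, Z (s + 1) ω ∂P ≤ ∫⁻ ω in A, Z s ω ∂P := by
    intro s hs A hA
    set V := fun ω => regGram c (fun k => x k ω) s
    set g : Ω → ℝ := fun ω => x s ω ⬝ᵥ ((V ω)⁻¹ *ᵥ noiseSum (fun k => x k ω) (fun k => ξ k ω) s)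
    set h : Ω → ℝ := fun ω => x s ω ⬝ᵥ ((V ω)⁻¹ *ᵥ x s ω)
    have hVm : ∀ i j, Measurable[m s] fun ω => V ω i j := fun i j =>
      measurable_regGram_apply (fun k hk => hx k s hk.le hs) c i j
    have hxs := hx s s le_rfl hs
    have hgm : Measurable[m s] g := @measurable_inv_quadratic Ω (m s) _ _ hVm _ _ hxs
      (measurable_noiseSum (fun k hk => hx k s hk.le hs) (fun k hk => hξ k s hk hs))
    have hhm : Measurable[m s] h := @measurable_inv_quadratic Ω (m s) _ _ hVm _ _ hxs hxs
    have h0 : ∀ ω, 0 ≤ h ω := fun ω => inv_quadratic_nonneg (regGram_posDef hc _ s) _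
    set D : Ω → ℝ := fun ω => Real.exp (-(g ω ^ 2 / (1 + h ω)) / 2) / Real.sqrt (1 + h ω)
    have h1m : Measurable[m s] fun ω => 1 + h ω := measurable_const.add hhm
    have hDm : Measurable[m s] D :=
      (((hgm.pow_const 2).div h1m).neg.div_const 2).exp.div h1m.sqrt
    have hD0 : ∀ ω, 0 ≤ D ω := fun ω => by positivity
    set Y : Ω → ENNReal := fun ω => A.indicator (fun ω => Z s ω * ENNReal.ofReal (D ω)) ω
    have hYm : Measurable[m s] Y :=
      ((hZm s s le_rfl hs).mul hDm.ennreal_ofReal).indicator hA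
    have hA' := hm s hs A hA
    rw [← lintegral_indicator hA', ← lintegral_indicator hA']
    have e1 : ∀ ω, A.indicator (Z (s + 1)) ω = Y ω * ENNReal.ofReal
        (Real.exp (g ω / (1 + h ω) * ξ s ω + h ω / (1 + h ω) * ξ s ω ^ 2 / 2)) := by
      intro ω
      by_cases hω : ω ∈ A
      · simp only [Y, Set.indicator_of_mem hω, hZ]
        rw [mixture_succ hc, ENNReal.ofReal_mul (by unfold mixture; positivity),
          ENNReal.ofReal_mul (by unfold mixture; positivity)]
      · simp [Y, Set.indicator_of_notMem hω]
    -- The bound for the exponential moment is exactly the reciprocal of the past-measurable factor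
    -- `D`, which is why the determinant prefactor makes `Z` a supermartingale.
    have e2 : ∀ ω, Y ω * ENNReal.ofReal
        (Real.sqrt (1 + h ω) * Real.exp ((g ω / (1 + h ω)) ^ 2 * (1 + h ω) / 2))
        = A.indicator (Z s) ω := by
      intro ω
      by_cases hω : ω ∈ A
      · simp only [Y, Set.indicator_of_mem hω]
        rw [mul_assoc, ← ENNReal.ofReal_mul (hD0 ω)]
        have hp : 0 < 1 + h ω := by have := h0 ω; positivity
        have hs0 : Real.sqrt (1 + h ω) ≠ 0 := (Real.sqrt_pos.2 hp).ne'
        have : D ω * (Real.sqrt (1 + h ω) * Real.exp ((g ω / (1 + h ω)) ^ 2 * (1 + h ω) / 2))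
            = 1 := by
          simp only [D]
          rw [div_mul_eq_mul_div, mul_left_comm, ← Real.exp_add]
          have : -(g ω ^ 2 / (1 + h ω)) / 2 + (g ω / (1 + h ω)) ^ 2 * (1 + h ω) / 2 = 0 := by
            field_simp
            ring
          rw [this, Real.exp_zero, mul_one, div_self hs0]
        rw [this, ENNReal.ofReal_one, mul_one]
      · simp [Y, Set.indicator_of_notMem hω]
    simp only [e1]
    refine ((hsg s hs).lintegral_exp_quadratic_le (hm s hs) (hξ' s hs) hYm (hgm.div h1m) hhm
      h0).trans_eq (lintegral_congr e2)
  have hZ0 : ∫⁻ ω, Z 0 ω ∂P ≤ 1 := by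
    have : ∀ ω, Z 0 ω = 1 := by
      intro ω
      simp [hZ, mixture, regGram, noiseSum, div_self (pow_ne_zero d hc.ne')]
    simp [this]
  have hville := mul_measure_exists_le_le_one hZ' hZm hstep hZ0 (ENNReal.ofReal (1 / δ))
  have hsub : ∀ ω, (∃ s ≤ M, 2 * Real.log (1 / δ)
        + Real.log ((regGram c (fun k => x k ω) s).det / c ^ d)
        ≤ noiseSum (fun k => x k ω) (fun k => ξ k ω) s ⬝ᵥ
          ((regGram c (fun k => x k ω) s)⁻¹ *ᵥ noiseSum (fun k => x k ω) (fun k => ξ k ω) s)) →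
      ∃ s ≤ M, ENNReal.ofReal (1 / δ) ≤ Z s ω := by
    rintro ω ⟨s, hs, hle⟩
    refine ⟨s, hs, ENNReal.ofReal_le_ofReal ?_⟩
    have hdet := (regGram_posDef hc (fun k => x k ω) s).det_pos
    set D := (regGram c (fun k => x k ω) s).det
    set q := noiseSum (fun k => x k ω) (fun k => ξ k ω) s ⬝ᵥ
          ((regGram c (fun k => x k ω) s)⁻¹ *ᵥ noiseSum (fun k => x k ω) (fun k => ξ k ω) s)
    have hsq : Real.sqrt (c ^ d / D) = Real.exp (Real.log (c ^ d / D) / 2) := by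
      rw [← Real.log_sqrt (by positivity), Real.exp_log (Real.sqrt_pos.2 (by positivity))]
    rw [mixture, hsq, ← Real.exp_add, ← Real.log_le_iff_le_exp (by positivity)]
    have : Real.log (c ^ d / D) = - Real.log (D / c ^ d) := by rw [← Real.log_inv, inv_div]
    rw [this]
    linarith
  refine (measure_mono hsub).trans ?_
  have h1 : ENNReal.ofReal δ * (ENNReal.ofReal (1 / δ)
      * P {ω | ∃ k ≤ M, ENNReal.ofReal (1 / δ) ≤ Z k ω}) ≤ ENNReal.ofReal δ * 1 := by gcongr
  rwa [← mul_assoc, ← ENNReal.ofReal_mul hδ.le, mul_one_div_cancel hδ.ne', ENNReal.ofReal_one,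
    one_mul, mul_one] at h1

end SelfNormalized

/-! ### Weighted sums of conditionally independent sub-Gaussian noise -/

section ConditionalNoise

open Filter Topology

/-- Conditional independence holds off a null set that depends on the box. Rational boxes are
countable, so one null set serves them all, and they still form a generating π-system that
determines the product law. -/
lemma eq_pi_of_forall_rat {N : ℕ} {ν : Measure (Fin N → ℝ)} [IsProbabilityMeasure ν]
    (h : ∀ a b : Fin N → ℚ,
      ν.real (⋂ i, (fun y => y i) ⁻¹' Set.Ioo (a i : ℝ) (b i : ℝ))
        = ∏ i, ν.real ((fun y => y i) ⁻¹' Set.Ioo (a i : ℝ) (b i : ℝ))) :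
    Measure.pi (fun i => ν.map fun y => y i) = ν := by
  have hprob : ∀ i, IsProbabilityMeasure (ν.map fun y => y i) := fun i =>
    Measure.isProbabilityMeasure_map (measurable_pi_apply i).aemeasurable
  refine Measure.pi_eq_generateFrom (fun i => Real.borel_eq_generateFrom_Ioo_rat.symm)
    (fun i => Real.isPiSystem_Ioo_rat) (fun i => Real.finiteSpanningSetsInIooRat _) ?_
  intro s hs
  simp only [Set.mem_iUnion, Set.mem_singleton_iff] at hs
  choose a b hab hsab using hs
  obtain rfl : s = fun i => Set.Ioo (a i : ℝ) (b i : ℝ) := funext hsab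
  have hpi : (Set.univ.pi fun i => Set.Ioo (a i : ℝ) (b i : ℝ))
      = ⋂ i, (fun y : Fin N → ℝ => y i) ⁻¹' Set.Ioo (a i : ℝ) (b i : ℝ) := by
    ext y; simp [Set.mem_pi]
  rw [hpi, ← ENNReal.toReal_eq_toReal_iff' (measure_ne_top _ _)
    (ENNReal.prod_ne_top fun i _ => measure_ne_top _ _), ENNReal.toReal_prod]
  have := h a b
  simp only [Measure.real] at this
  rw [this]
  refine Finset.prod_congr rfl fun i _ => ?_
  rw [Measure.map_apply (measurable_pi_apply i) measurableSet_Ioo]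

/-- For the same reason the sub-Gaussian bound is first available for rational exponents only;
Fatou's lemma along rational approximations extends it. -/
lemma lintegral_exp_le_of_forall_rat {ν : Measure ℝ} {v : ℝ}
    (h : ∀ q : ℚ, ∫⁻ y, ENNReal.ofReal (Real.exp (q * y)) ∂ν
      ≤ ENNReal.ofReal (Real.exp ((q : ℝ) ^ 2 * v / 2))) (c : ℝ) :
    ∫⁻ y, ENNReal.ofReal (Real.exp (c * y)) ∂ν ≤ ENNReal.ofReal (Real.exp (c ^ 2 * v / 2)) := by
  obtain ⟨u, hu, hlim⟩ := mem_closure_iff_seq_limit.1 (Rat.denseRange_cast (𝕜 := ℝ) c)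
  choose q hq using hu
  have hlim' : Tendsto (fun n => (q n : ℝ)) atTop (𝓝 c) := by simpa [hq] using hlim
  have h1 : ∀ y, ENNReal.ofReal (Real.exp (c * y))
      = liminf (fun n => ENNReal.ofReal (Real.exp (q n * y))) atTop := by
    intro y
    refine (Tendsto.liminf_eq ?_).symm
    exact (ENNReal.continuous_ofReal.comp (Real.continuous_exp.comp
      (continuous_id.mul continuous_const))).continuousAt.tendsto.comp hlim'
  have h2 : Tendsto (fun n => ENNReal.ofReal (Real.exp ((q n : ℝ) ^ 2 * v / 2))) atTop
      (𝓝 (ENNReal.ofReal (Real.exp (c ^ 2 * v / 2)))) := by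
    have hc : Continuous fun t : ℝ => ENNReal.ofReal (Real.exp (t ^ 2 * v / 2)) :=
      ENNReal.continuous_ofReal.comp (by fun_prop)
    exact hc.continuousAt.tendsto.comp hlim'
  simp only [h1]
  refine (lintegral_liminf_le fun n => by fun_prop).trans ?_
  rw [← h2.liminf_eq]
  exact liminf_le_liminf (Eventually.of_forall fun n => h (q n))

variable {Ω β : Type*} {mΩ : MeasurableSpace Ω} {mβ : MeasurableSpace β} {P : Measure Ω}
  [IsProbabilityMeasure P] {N : ℕ} {X : Ω → β} {η : Fin N → Ω → ℝ} {R : ℝ}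

lemma lintegral_condDistrib_exp_le (hX : Measurable X) (hη : ∀ i, Measurable (η i))
    (hsg : ∀ i, CondSubGaussian P (mβ.comap X) R (η i)) :
    ∀ᵐ ω ∂P, ∀ i (c : ℝ), ∫⁻ y, ENNReal.ofReal (Real.exp (c * y i))
        ∂(condDistrib (fun ω i => η i ω) X P (X ω))
      ≤ ENNReal.ofReal (Real.exp (c ^ 2 * R ^ 2 / 2)) := by
  have hηm : Measurable fun ω i => η i ω := measurable_pi_lambda _ hη
  have hrat : ∀ᵐ ω ∂P, ∀ i (q : ℚ), ∫⁻ y, ENNReal.ofReal (Real.exp (q * y i))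
        ∂(condDistrib (fun ω i => η i ω) X P (X ω))
      ≤ ENNReal.ofReal (Real.exp ((q : ℝ) ^ 2 * R ^ 2 / 2)) := by
    rw [ae_all_iff]; intro i
    rw [ae_all_iff]; intro q
    obtain ⟨hint, hle⟩ := (hsg i).2.2 q
    have hf : StronglyMeasurable fun y : Fin N → ℝ => Real.exp (q * y i) :=
      (Measurable.stronglyMeasurable (by fun_prop))
    have heq := condExp_ae_eq_integral_condDistrib (f := fun y : Fin N → ℝ => Real.exp (q * y i))
      hX hηm.aemeasurable hf hint
    have hint' : Integrable (fun p : β × (Fin N → ℝ) => Real.exp (q * p.2 i))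
        (P.map fun ω => (X ω, fun i => η i ω)) := by
      rw [integrable_map_measure (by fun_prop) (hX.prodMk hηm).aemeasurable]
      exact hint
    have hae := hint'.condDistrib_ae hX.aemeasurable hηm.aemeasurable
    filter_upwards [hle, heq, hae] with ω h1 h2 h3
    rw [← ofReal_integral_eq_lintegral_ofReal h3 (ae_of_all _ fun _ => (Real.exp_pos _).le)]
    refine ENNReal.ofReal_le_ofReal ?_
    rw [← h2]
    exact h1
  filter_upwards [hrat] with ω hω i c
  have := lintegral_exp_le_of_forall_rat (v := R ^ 2)
    (ν := (condDistrib (fun ω i => η i ω) X P (X ω)).map fun y => y i) (fun q => by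
      rw [lintegral_map (by fun_prop) (measurable_pi_apply i)]; exact hω i q) c
  rwa [lintegral_map (by fun_prop) (measurable_pi_apply i)] at this

lemma condDistrib_eq_pi (hX : Measurable X) (hη : ∀ i, Measurable (η i))
    (hind : CondIndepFamily P (mβ.comap X) η) :
    ∀ᵐ ω ∂P, Measure.pi (fun i => (condDistrib (fun ω i => η i ω) X P (X ω)).map fun y => y i)
      = condDistrib (fun ω i => η i ω) X P (X ω) := by
  have hηm : Measurable fun ω i => η i ω := measurable_pi_lambda _ hη
  have hrat : ∀ᵐ ω ∂P, ∀ ab : (Fin N → ℚ) × (Fin N → ℚ),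
      (condDistrib (fun ω i => η i ω) X P (X ω)).real
          (⋂ i, (fun y => y i) ⁻¹' Set.Ioo (ab.1 i : ℝ) (ab.2 i : ℝ))
        = ∏ i, (condDistrib (fun ω i => η i ω) X P (X ω)).real
          ((fun y => y i) ⁻¹' Set.Ioo (ab.1 i : ℝ) (ab.2 i : ℝ)) := by
    rw [ae_all_iff]
    rintro ⟨a, b⟩
    have hB : ∀ i, MeasurableSet ((fun y : Fin N → ℝ => y i) ⁻¹' Set.Ioo (a i : ℝ) (b i : ℝ)) :=
      fun i => measurable_pi_apply i measurableSet_Ioo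
    have h1 := condDistrib_ae_eq_condExp (μ := P) hX hηm (MeasurableSet.iInter hB)
    have h2 : ∀ᵐ ω ∂P, ∀ i, (condDistrib (fun ω i => η i ω) X P (X ω)).real
        ((fun y => y i) ⁻¹' Set.Ioo (a i : ℝ) (b i : ℝ))
        = (P[(η i ⁻¹' Set.Ioo (a i : ℝ) (b i : ℝ)).indicator (fun _ => (1 : ℝ)) | mβ.comap X]) ω :=
      ae_all_iff.2 fun i => condDistrib_ae_eq_condExp (μ := P) hX hηm (hB i)
    have h3 := hind (fun i => Set.Ioo (a i : ℝ) (b i : ℝ)) fun i => measurableSet_Ioo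
    filter_upwards [h1, h2, h3] with ω e1 e2 e3
    rw [e1, Finset.prod_congr rfl fun i _ => e2 i, ← e3, Set.preimage_iInter]
    rfl
  filter_upwards [hrat] with ω hω
  exact eq_pi_of_forall_rat fun a b => hω (a, b)

lemma lintegral_exp_sum_le {ν : Measure (Fin N → ℝ)} [IsProbabilityMeasure ν]
    (hpi : Measure.pi (fun i => ν.map fun y => y i) = ν)
    (hexp : ∀ i (c : ℝ), ∫⁻ y, ENNReal.ofReal (Real.exp (c * y i)) ∂ν
      ≤ ENNReal.ofReal (Real.exp (c ^ 2 * R ^ 2 / 2))) (c : Fin N → ℝ) :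
    ∫⁻ y, ENNReal.ofReal (Real.exp (∑ i, c i * y i)) ∂ν
      ≤ ENNReal.ofReal (Real.exp ((∑ i, c i ^ 2) * R ^ 2 / 2)) := by
  have hprob : ∀ i, IsProbabilityMeasure (ν.map fun y => y i) := fun i =>
    Measure.isProbabilityMeasure_map (measurable_pi_apply i).aemeasurable
  have hind : iIndepFun (fun i (y : Fin N → ℝ) => ENNReal.ofReal (Real.exp (c i * y i))) ν := by
    have := iIndepFun_pi (μ := fun i => ν.map fun y => y i)
      (X := fun i (t : ℝ) => ENNReal.ofReal (Real.exp (c i * t)))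
      (fun i => Measurable.aemeasurable (by fun_prop))
    rwa [hpi] at this
  have hprod : ∀ y : Fin N → ℝ, ENNReal.ofReal (Real.exp (∑ i, c i * y i))
      = ∏ i, ENNReal.ofReal (Real.exp (c i * y i)) := fun y => by
    rw [Real.exp_sum, ENNReal.ofReal_prod_of_nonneg fun i _ => (Real.exp_pos _).le]
  simp only [hprod]
  rw [ProbabilityTheory.lintegral_prod_eq_prod_lintegral_of_indepFun _ _ hind
    (fun i => by fun_prop)]
  refine (Finset.prod_le_prod' fun i _ => hexp i (c i)).trans_eq ?_
  rw [← ENNReal.ofReal_prod_of_nonneg fun i _ => (Real.exp_pos _).le, ← Real.exp_sum,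
    Finset.sum_mul, Finset.sum_div]

/-- After disintegration along `X`, the noise vector has a product law for almost every value of
`X`, while `C` and `Y` are constants; the exponential moment then factors over the agents. -/
lemma lintegral_weighted_noise_le (hX : Measurable X) (hη : ∀ i, Measurable (η i))
    (hsg : ∀ i, CondSubGaussian P (mβ.comap X) R (η i))
    (hind : CondIndepFamily P (mβ.comap X) η) {w : Fin N → ℝ} {σ : ℝ} (hσ : 0 < σ)
    (hw : R ^ 2 * ∑ i, w i ^ 2 ≤ σ ^ 2) {C : β → ℝ} {Y : β → ENNReal} (hC : Measurable C)
    (hY : Measurable Y) :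
    ∫⁻ ω, Y (X ω) * ENNReal.ofReal
        (Real.exp (C (X ω) * ((∑ i, w i * η i ω) / σ) - C (X ω) ^ 2 / 2)) ∂P
      ≤ ∫⁻ ω, Y (X ω) ∂P := by
  have hηm : Measurable fun ω i => η i ω := measurable_pi_lambda _ hη
  set κ := condDistrib (fun ω i => η i ω) X P
  set F : β × (Fin N → ℝ) → ENNReal := fun p => Y p.1 * ENNReal.ofReal
    (Real.exp (C p.1 * ((∑ i, w i * p.2 i) / σ) - C p.1 ^ 2 / 2)) with hF
  have hFm : Measurable F := by
    simp only [hF]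
    fun_prop
  have h1 : ∫⁻ ω, F (X ω, fun i => η i ω) ∂P = ∫⁻ ω, ∫⁻ y, F (X ω, y) ∂(κ (X ω)) ∂P := by
    rw [← lintegral_map hFm (hX.prodMk hηm), ← compProd_map_condDistrib hηm.aemeasurable,
      Measure.lintegral_compProd hFm, lintegral_map hFm.lintegral_kernel_prod_right' hX]
  change ∫⁻ ω, F (X ω, fun i => η i ω) ∂P ≤ _
  rw [h1]
  refine lintegral_mono_ae ?_
  filter_upwards [lintegral_condDistrib_exp_le hX hη hsg, condDistrib_eq_pi hX hη hind]
    with ω hexp hpi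
  have h2 := lintegral_exp_sum_le hpi hexp fun i => C (X ω) * w i / σ
  have h3 : ∀ y, F (X ω, y) = Y (X ω) * ENNReal.ofReal (Real.exp (- C (X ω) ^ 2 / 2))
      * ENNReal.ofReal (Real.exp (∑ i, C (X ω) * w i / σ * y i)) := by
    intro y
    simp only [hF]
    rw [mul_assoc, ← ENNReal.ofReal_mul (Real.exp_pos _).le, ← Real.exp_add, Finset.sum_div,
      Finset.mul_sum, sub_eq_add_neg, add_comm, neg_div]
    congr 4
    refine Finset.sum_congr rfl fun i _ => ?_
    ring
  simp only [h3]
  rw [lintegral_const_mul _ (by fun_prop)]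
  refine (mul_le_mul_right h2 _).trans ?_
  rw [mul_assoc, ← ENNReal.ofReal_mul (Real.exp_pos _).le, ← Real.exp_add]
  refine mul_le_of_le_one_right' ?_
  rw [ENNReal.ofReal_le_one, Real.exp_le_one_iff]
  have h4 : (∑ i, (C (X ω) * w i / σ) ^ 2) * R ^ 2
      = C (X ω) ^ 2 * ((R ^ 2 * ∑ i, w i ^ 2) / σ ^ 2) := by
    have : ∀ i, (C (X ω) * w i / σ) ^ 2 = C (X ω) ^ 2 / σ ^ 2 * w i ^ 2 := fun i => by ring
    simp only [this, ← Finset.mul_sum]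
    ring
  have h5 : (R ^ 2 * ∑ i, w i ^ 2) / σ ^ 2 ≤ 1 := by
    rw [div_le_one (by positivity)]; exact hw
  rw [h4]
  nlinarith [mul_le_mul_of_nonneg_left h5 (sq_nonneg (C (X ω)))]

/-- A weighted sum of conditionally independent sub-Gaussian variables, normalized by its
variance proxy, is conditionally standard sub-Gaussian. -/
lemma isStandardSubGaussian_sum {m : MeasurableSpace Ω} (hm : m ≤ mΩ)
    (hη : ∀ i, Measurable[mΩ] (η i)) (hsg : ∀ i, CondSubGaussian P m R (η i))
    (hind : CondIndepFamily P m η) {w : Fin N → ℝ} {σ : ℝ} (hσ : 0 < σ)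
    (hw : R ^ 2 * ∑ i, w i ^ 2 ≤ σ ^ 2) :
    IsStandardSubGaussian P m fun ω => (∑ i, w i * η i ω) / σ := by
  intro C Y hC hY
  -- The σ-algebra `m` is encoded as the identity map from `(Ω, mΩ)` to `(Ω, m)`. Only the noise
  -- space `Fin N → ℝ` then has to be standard Borel, not `Ω`.
  have hid : @Measurable Ω Ω mΩ m id := measurable_id'' hm
  have hcomap : m.comap (id : Ω → Ω) = m := MeasurableSpace.comap_id
  exact @lintegral_weighted_noise_le Ω Ω mΩ m P _ N id η R hid hη (by rwa [hcomap])
    (by rwa [hcomap]) w σ hσ hw C Y hC hY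

/-- Conditionally `0`-sub-Gaussian variables vanish almost surely. -/
lemma CondSubGaussian.ae_eq_zero {m : MeasurableSpace Ω} (hm : m ≤ mΩ) {Y : Ω → ℝ}
    (h : CondSubGaussian P m 0 Y) : ∀ᵐ ω ∂P, Y ω = 0 := by
  obtain ⟨hint, hmean, hexp⟩ := h
  obtain ⟨hint1, hle⟩ := hexp 1
  have h0 : ∫ ω, Y ω ∂P = 0 := by
    rw [← integral_condExp hm, integral_congr_ae hmean]
    simp
  have h1 : ∫ ω, Real.exp (1 * Y ω) ∂P ≤ 1 := by
    rw [← integral_condExp hm]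
    refine (integral_mono_ae integrable_condExp (integrable_const _) hle).trans ?_
    simp
  -- `exp y - y - 1` is nonnegative and vanishes only at 0, while its mean at `y = Y` is at most 0.
  have hnn : ∀ ω, 0 ≤ Real.exp (1 * Y ω) - Y ω - 1 := fun ω => by
    rw [one_mul]
    linarith [Real.add_one_le_exp (Y ω)]
  have hint3 : Integrable (fun ω => Real.exp (1 * Y ω) - Y ω) P := hint1.sub hint
  have hint2 : Integrable (fun ω => Real.exp (1 * Y ω) - Y ω - 1) P :=
    hint3.sub (integrable_const _)
  have h2 : ∫ ω, (Real.exp (1 * Y ω) - Y ω - 1) ∂P = 0 := by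
    refine le_antisymm ?_ (integral_nonneg hnn)
    rw [integral_sub hint3 (integrable_const _), integral_sub hint1 hint, h0]
    simpa using h1
  have h3 := (integral_eq_zero_iff_of_nonneg hnn hint2).1 h2
  filter_upwards [h3] with ω hω
  by_contra hne
  have := Real.add_one_lt_exp hne
  simp only [one_mul, Pi.zero_apply] at hω
  linarith

end ConditionalNoise

/-! ### Uniform control of the noise -/

section NoiseControl

variable {Ω : Type*} {d : ℕ}

lemma sq_dotProduct_le (u v : Fin d → ℝ) : (u ⬝ᵥ v) ^ 2 ≤ (u ⬝ᵥ u) * (v ⬝ᵥ v) := by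
  simp only [dotProduct]
  have h := Finset.sum_mul_sq_le_sq_mul_sq Finset.univ u v
  simpa only [sq] using h

lemma dotProduct_self_nonneg' (u : Fin d → ℝ) : 0 ≤ u ⬝ᵥ u :=
  Finset.sum_nonneg fun i _ => mul_self_nonneg (u i)

/-- Deterministic consequence of the self-normalized bound, when the `k`-th variance proxy is
inflated by the factor `1 + ν k`. -/
lemma abs_sum_noise_le_of_selfNormalized (hd : 2 ≤ d) {s : ℕ} (hs : 1 ≤ s) {X : ℕ → Fin d → ℝ}
    {n ν : ℕ → ℝ} {ς L V c lam δ : ℝ} (hς : 0 < ς) (hν : ∀ k, 0 ≤ ν k)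
    (hX : ∀ k < s, X k ⬝ᵥ X k ≤ L ^ 2) (hV : ∑ k ∈ Finset.range s, ν k ≤ V) (hc : 0 < c)
    (hlam : c + L ^ 2 * V ≤ lam) (htr : (s + V) * L ^ 2 ≤ d * c * (s * L ^ 2 / lam))
    (hδ : 0 < δ) (hδ1 : δ ≤ 1)
    (hq : noiseSum (fun k => Real.sqrt (1 + ν k) • X k)
          (fun k => n k / (ς * Real.sqrt (1 + ν k))) s ⬝ᵥ
        ((regGram c (fun k => Real.sqrt (1 + ν k) • X k) s)⁻¹ *ᵥ
          noiseSum (fun k => Real.sqrt (1 + ν k) • X k)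
            (fun k => n k / (ς * Real.sqrt (1 + ν k))) s)
        ≤ 2 * Real.log (1 / δ)
          + Real.log ((regGram c (fun k => Real.sqrt (1 + ν k) • X k) s).det / c ^ d))
    (u : Fin d → ℝ) :
    |∑ k ∈ Finset.range s, n k * (u ⬝ᵥ X k)|
      ≤ ς * Real.sqrt (d * Real.log ((1 + s * L ^ 2 / lam) / δ))
        * Real.sqrt (u ⬝ᵥ (regGram lam X s *ᵥ u)) := by
  -- The rescaling normalizes the variance proxies while keeping each product `ξ k • x k` equal to
  -- `(n k / ς) • X k`.
  set x : ℕ → Fin d → ℝ := fun k => Real.sqrt (1 + ν k) • X k with hx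
  set ξ : ℕ → ℝ := fun k => n k / (ς * Real.sqrt (1 + ν k))
  have hV0 : 0 ≤ V := (Finset.sum_nonneg fun k _ => hν k).trans hV
  have hlam0 : 0 < lam := lt_of_lt_of_le hc ((le_add_of_nonneg_right (by positivity)).trans hlam)
  have hpd := regGram_posDef hc x s
  have hsq : ∀ k, Real.sqrt (1 + ν k) ^ 2 = 1 + ν k := fun k =>
    Real.sq_sqrt (by have := hν k; positivity)
  have hs0 : ∀ k, Real.sqrt (1 + ν k) ≠ 0 := fun k =>
    (Real.sqrt_pos.2 (by have := hν k; positivity)).ne'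
  have hxx : ∀ k, x k ⬝ᵥ x k = (1 + ν k) * (X k ⬝ᵥ X k) := fun k => by
    simp only [hx, smul_dotProduct, dotProduct_smul, smul_eq_mul]
    rw [← mul_assoc, ← sq, hsq]
  have hux : ∀ k, (u ⬝ᵥ x k) ^ 2 = (1 + ν k) * (u ⬝ᵥ X k) ^ 2 := fun k => by
    simp only [hx, dotProduct_smul, smul_eq_mul, mul_pow, hsq]
  have hS : u ⬝ᵥ noiseSum x ξ s = (∑ k ∈ Finset.range s, n k * (u ⬝ᵥ X k)) / ς := by
    rw [noiseSum, dotProduct_sum, Finset.sum_div]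
    refine Finset.sum_congr rfl fun k _ => ?_
    simp only [ξ, hx, dotProduct_smul, smul_eq_mul]
    have := hs0 k
    field_simp
  -- The rescaling adds `∑ ν_k X_k X_kᵀ ≤ L² V I` to the Gram matrix; the gap between `c` and `lam`
  -- compensates for it.
  have hQ : u ⬝ᵥ (regGram c x s *ᵥ u) ≤ u ⬝ᵥ (regGram lam X s *ᵥ u) := by
    rw [regGram_quadratic, regGram_quadratic]
    have h1 : ∑ k ∈ Finset.range s, ν k * (u ⬝ᵥ X k) ^ 2 ≤ V * ((u ⬝ᵥ u) * L ^ 2) := by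
      calc _ ≤ ∑ k ∈ Finset.range s, ν k * ((u ⬝ᵥ u) * L ^ 2) := by
            refine Finset.sum_le_sum fun k hk => mul_le_mul_of_nonneg_left ?_ (hν k)
            exact (sq_dotProduct_le _ _).trans (mul_le_mul_of_nonneg_left
              (hX k (Finset.mem_range.1 hk)) (dotProduct_self_nonneg' u))
        _ = (∑ k ∈ Finset.range s, ν k) * ((u ⬝ᵥ u) * L ^ 2) := by rw [Finset.sum_mul]
        _ ≤ _ := mul_le_mul_of_nonneg_right hV
            (mul_nonneg (dotProduct_self_nonneg' u) (sq_nonneg L))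
    have h2 := mul_le_mul_of_nonneg_right hlam (dotProduct_self_nonneg' u)
    simp only [hux, add_mul, one_mul, Finset.sum_add_distrib] at h2 ⊢
    linarith
  have hQ0 : 0 ≤ u ⬝ᵥ (regGram lam X s *ᵥ u) := by
    simpa using (regGram_posDef hlam0 X s).posSemidef.dotProduct_mulVec_nonneg u
  have hsp : (0 : ℝ) ≤ s * L ^ 2 / lam := by positivity
  -- The actions add at most `(s + V) L²` to the trace, while the target determinant allows `d c s
  -- L² / lam`; the spare factor `d` covers both `V` and the smaller regularizer.
  have hdet : (regGram c x s).det ≤ (c * (1 + s * L ^ 2 / lam)) ^ d := by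
    refine det_le_pow_of_trace_le hpd (by positivity) ?_
    rw [regGram_trace]
    have h1 : ∑ k ∈ Finset.range s, x k ⬝ᵥ x k ≤ (s + V) * L ^ 2 := by
      calc _ ≤ ∑ k ∈ Finset.range s, (1 + ν k) * L ^ 2 := by
            refine Finset.sum_le_sum fun k hk => ?_
            rw [hxx]
            exact mul_le_mul_of_nonneg_left (hX k (Finset.mem_range.1 hk))
              (by have := hν k; positivity)
        _ = (s + ∑ k ∈ Finset.range s, ν k) * L ^ 2 := by
            rw [← Finset.sum_mul, Finset.sum_add_distrib]; simp
        _ ≤ _ := by gcongr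
    linarith
  have hlogdet : Real.log ((regGram c x s).det / c ^ d)
      ≤ d * Real.log (1 + s * L ^ 2 / lam) := by
    rw [← Real.log_pow]
    refine Real.log_le_log (div_pos hpd.det_pos (by positivity)) ?_
    rw [div_le_iff₀ (by positivity), mul_comm, ← mul_pow]
    exact hdet
  have hlogδ : 0 ≤ Real.log (1 / δ) := Real.log_nonneg (by rw [le_div_iff₀ hδ]; linarith)
  have hd' : (2 : ℝ) ≤ d := by exact_mod_cast hd
  set T := d * Real.log ((1 + s * L ^ 2 / lam) / δ) with hT
  have hTeq : T = d * Real.log (1 + s * L ^ 2 / lam) + d * Real.log (1 / δ) := by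
    rw [hT, div_eq_mul_one_div, Real.log_mul (by positivity) (by positivity)]
    ring
  -- Here `d ≥ 2` lets `d log (1/δ)` dominate `2 log (1/δ)`.
  have hqT := hq.trans (show _ ≤ T by
    rw [hTeq]
    have := mul_le_mul_of_nonneg_right hd' hlogδ
    linarith)
  have hT0 : 0 ≤ T := (inv_quadratic_nonneg hpd _).trans hqT
  have hcs := sq_dotProduct_le_inv_quadratic hpd u (noiseSum x ξ s)
  have hfin : (u ⬝ᵥ noiseSum x ξ s) ^ 2 ≤ T * (u ⬝ᵥ (regGram lam X s *ᵥ u)) := by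
    refine hcs.trans (mul_le_mul hqT hQ ?_ hT0)
    simpa using hpd.posSemidef.dotProduct_mulVec_nonneg u
  rw [mul_assoc, ← Real.sqrt_mul hT0]
  have h1 := Real.abs_le_sqrt hfin
  rw [hS, abs_div, abs_of_pos hς, div_le_iff₀ hς] at h1
  linarith

/-- With probability at least `1 - δ`, the noise sums are controlled uniformly over all
`s ≤ M` and all directions. -/
lemma measure_exists_noise_gt_le (hd : 2 ≤ d) {mΩ : MeasurableSpace Ω} {P : Measure Ω}
    [IsProbabilityMeasure P] {M : ℕ} {m : ℕ → MeasurableSpace Ω} (hm : ∀ k < M, m k ≤ mΩ)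
    {X : ℕ → Ω → Fin d → ℝ} {n : ℕ → Ω → ℝ} (hXm : ∀ j k, j ≤ k → k < M → Measurable[m k] (X j))
    (hn : ∀ j k, j < k → k < M → Measurable[m k] (n j)) (hn' : ∀ k < M, Measurable (n k))
    {ν : ℕ → ℝ} (hν : ∀ k, 0 ≤ ν k) {ς : ℝ} (hς : 0 < ς)
    (hsg : ∀ k < M, IsStandardSubGaussian P (m k) fun ω => n k ω / (ς * Real.sqrt (1 + ν k)))
    {L V c lam δ : ℝ} (hX : ∀ k < M, ∀ᵐ ω ∂P, X k ω ⬝ᵥ X k ω ≤ L ^ 2)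
    (hV : ∀ s ≤ M, ∑ k ∈ Finset.range s, ν k ≤ V) (hc : 0 < c)
    (hlam : c + L ^ 2 * V ≤ lam)
    (htr : ∀ s : ℕ, 1 ≤ s → (s + V) * L ^ 2 ≤ d * c * (s * L ^ 2 / lam))
    (hδ : 0 < δ) (hδ1 : δ ≤ 1) :
    P {ω | ∃ s ≤ M, ∃ u : Fin d → ℝ, ς * Real.sqrt (d * Real.log ((1 + s * L ^ 2 / lam) / δ))
        * Real.sqrt (u ⬝ᵥ (regGram lam (fun k => X k ω) s *ᵥ u))
        < |∑ k ∈ Finset.range s, n k ω * (u ⬝ᵥ X k ω)|} ≤ ENNReal.ofReal δ := by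
  have hxm : ∀ j k, j ≤ k → k < M → Measurable[m k] fun ω => Real.sqrt (1 + ν j) • X j ω :=
    fun j k hjk hk => (hXm j k hjk hk).const_smul (Real.sqrt (1 + ν j))
  have hmain := measure_exists_selfNormalized_le (P := P) (M := M) hm (c := c) (δ := δ)
    (x := fun k ω => Real.sqrt (1 + ν k) • X k ω)
    (ξ := fun k ω => n k ω / (ς * Real.sqrt (1 + ν k))) hxm
    (fun j k hjk hk => (hn j k hjk hk).div_const _)
    (fun k hk => (hn' k hk).div_const _) hsg hc hδ
  refine (measure_mono_ae ?_).trans hmain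
  have hX' : ∀ᵐ ω ∂P, ∀ k, k < M → X k ω ⬝ᵥ X k ω ≤ L ^ 2 :=
    ae_all_iff.2 fun k => by
      by_cases hk : k < M
      · filter_upwards [hX k hk] with ω hω _ using hω
      · exact ae_of_all _ fun ω h => absurd h hk
  filter_upwards [hX'] with ω hω
  rintro ⟨s, hs, u, hlt⟩
  by_contra hcon
  -- At `s = 0` the noise sum is empty; the trace condition is assumed only from `s = 1` on.
  have hs1 : 1 ≤ s := by
    by_contra h0
    have : s = 0 := by omega
    subst this
    simp only [Finset.range_zero, Finset.sum_empty, abs_zero] at hlt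
    exact absurd hlt (not_lt.2 (by positivity))
  refine absurd hlt (not_lt.2 ?_)
  refine abs_sum_noise_le_of_selfNormalized hd hs1 (X := fun k => X k ω) (n := fun k => n k ω)
    hς hν (fun k hk => hω k (by omega)) (hV s hs) hc hlam (htr s hs1) hδ hδ1 ?_ u
  by_contra hlt'
  exact hcon ⟨s, hs, (not_le.1 hlt').le⟩

end NoiseControl

/-! ### Confidence ellipsoids along one trajectory -/

section Deterministic

lemma sq_add_le_mul_add {A B a₁ a₂ b₁ b₂ : ℝ} (ha₁ : 0 ≤ a₁) (ha₂ : 0 ≤ a₂) (hb₁ : 0 ≤ b₁)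
    (hb₂ : 0 ≤ b₂) (hA : A ^ 2 ≤ a₁ * a₂) (hB : B ^ 2 ≤ b₁ * b₂) :
    (A + B) ^ 2 ≤ (a₁ + b₁) * (a₂ + b₂) := by
  have h : (2 * (A * B)) ^ 2 ≤ (a₁ * b₂ + b₁ * a₂) ^ 2 := by
    have h1 : A ^ 2 * B ^ 2 ≤ (a₁ * a₂) * (b₁ * b₂) :=
      mul_le_mul hA hB (sq_nonneg B) (by positivity)
    nlinarith [sq_nonneg (a₁ * b₂ - b₁ * a₂)]
  have h2 := abs_le_of_sq_le_sq h (by positivity)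
  nlinarith [le_abs_self (2 * (A * B))]

variable {N d : ℕ} {p : Problem N d}

lemma inner_eq_dotProduct (x y : EuclideanSpace ℝ (Fin d)) : ⟪x, y⟫ = x.ofLp ⬝ᵥ y.ofLp := by
  rw [EuclideanSpace.inner_eq_star_dotProduct, star_trivial, dotProduct_comm]

lemma norm_sq_eq_dotProduct (x : EuclideanSpace ℝ (Fin d)) : ‖x‖ ^ 2 = x.ofLp ⬝ᵥ x.ofLp := by
  rw [← inner_eq_dotProduct, real_inner_self_eq_norm_sq]

lemma sum_Icc_one_eq_sum_range {M : Type*} [AddCommMonoid M] (f : ℕ → M) (s : ℕ) :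
    ∑ k ∈ Finset.Icc 1 s, f k = ∑ k ∈ Finset.range s, f (k + 1) := by
  induction s with
  | zero => simp
  | succ s ih => rw [Finset.sum_Icc_succ_top (by omega), ih, Finset.sum_range_succ]

lemma gram_eq_regGram (x : ℕ → EuclideanSpace ℝ (Fin d)) (s : ℕ) :
    p.gram x s = regGram p.lam (fun k => (x (k + 1)).ofLp) s := by
  rw [Problem.gram, regGram, sum_Icc_one_eq_sum_range]

/-- The quadratic form of the Gram matrix at the estimation error. -/
lemma gram_quadratic_sub_estimate (hlam : 0 < p.lam) (x : ℕ → EuclideanSpace ℝ (Fin d))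
    (η : Fin N → ℕ → ℝ) (s : ℕ) (i : Fin N) (θ : EuclideanSpace ℝ (Fin d)) :
    let u := (θ - p.estimate x η s i).ofLp
    u ⬝ᵥ (p.gram x s *ᵥ u) = p.lam * (u ⬝ᵥ θ.ofLp)
      - ∑ k ∈ Finset.range s, (p.consensus x η (k + 1) i - ⟪x (k + 1), θ⟫)
        * (u ⬝ᵥ (x (k + 1)).ofLp) := by
  intro u
  have hpd : (p.gram x s).PosDef := by rw [gram_eq_regGram]; exact regGram_posDef hlam _ _
  have hu : u = θ.ofLp - (p.estimate x η s i).ofLp := rfl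
  have hest : p.gram x s *ᵥ (p.estimate x η s i).ofLp
      = ∑ k ∈ Finset.range s, p.consensus x η (k + 1) i • (x (k + 1)).ofLp := by
    change p.gram x s *ᵥ ((p.gram x s)⁻¹ *ᵥ _) = _
    rw [Matrix.mulVec_mulVec, Matrix.mul_nonsing_inv _ hpd.det_pos.ne'.isUnit, Matrix.one_mulVec,
      sum_Icc_one_eq_sum_range, WithLp.ofLp_sum]
    rfl
  have hθ : u ⬝ᵥ (p.gram x s *ᵥ θ.ofLp) = p.lam * (u ⬝ᵥ θ.ofLp)
      + ∑ k ∈ Finset.range s, ⟪x (k + 1), θ⟫ * (u ⬝ᵥ (x (k + 1)).ofLp) := by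
    rw [gram_eq_regGram, regGram, Matrix.add_mulVec, dotProduct_add, Matrix.smul_mulVec,
      Matrix.one_mulVec, dotProduct_smul, smul_eq_mul, Matrix.sum_mulVec, dotProduct_sum]
    congr 1
    refine Finset.sum_congr rfl fun k _ => ?_
    rw [Matrix.vecMulVec_mulVec, inner_eq_dotProduct]
    simp [dotProduct_smul]
  conv_lhs => rw [show p.gram x s *ᵥ u = p.gram x s *ᵥ θ.ofLp - p.gram x s *ᵥ
    (p.estimate x η s i).ofLp by rw [hu, Matrix.mulVec_sub]]
  rw [dotProduct_sub, hθ, hest, dotProduct_sum]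
  simp only [dotProduct_smul, smul_eq_mul, sub_mul, Finset.sum_sub_distrib]
  ring

/-- An error bound for the estimate from a splitting of the observation errors into three parts. -/
lemma weightedNorm_sub_estimate_le (hlam : 0 < p.lam) {x : ℕ → EuclideanSpace ℝ (Fin d)}
    {η : Fin N → ℕ → ℝ} {s : ℕ} {i : Fin N} {θ : EuclideanSpace ℝ (Fin d)} {b r n : ℕ → ℝ}
    (hsplit : ∀ k < s, p.consensus x η (k + 1) i - ⟪x (k + 1), θ⟫ = b k + r k + n k)
    {B₁ B₂ B₃ : ℝ} (hB₁ : 0 ≤ B₁) (hb : p.lam * ‖θ‖ ^ 2 + ∑ k ∈ Finset.range s, b k ^ 2 ≤ B₁ ^ 2)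
    (hn : ∀ u : Fin d → ℝ, |∑ k ∈ Finset.range s, n k * (u ⬝ᵥ (x (k + 1)).ofLp)|
      ≤ B₂ * Real.sqrt (u ⬝ᵥ (p.gram x s *ᵥ u)))
    (hr : ∀ u : Fin d → ℝ, |∑ k ∈ Finset.range s, r k * (u ⬝ᵥ (x (k + 1)).ofLp)|
      ≤ B₃ * Real.sqrt (u ⬝ᵥ (p.gram x s *ᵥ u))) (hB₂₃ : 0 ≤ B₂ + B₃) :
    weightedNorm (p.gram x s) (θ - p.estimate x η s i) ≤ B₂ + B₁ + B₃ := by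
  have hid := gram_quadratic_sub_estimate hlam x η s i θ
  simp only at hid
  set u := (θ - p.estimate x η s i).ofLp
  change Real.sqrt (u ⬝ᵥ (p.gram x s *ᵥ u)) ≤ _
  have hQ := regGram_quadratic p.lam (fun k => (x (k + 1)).ofLp) s u
  rw [← gram_eq_regGram] at hQ
  specialize hn u
  specialize hr u
  set Q := u ⬝ᵥ (p.gram x s *ᵥ u)
  have huu := dotProduct_self_nonneg' u
  have hQ0 : 0 ≤ Q := by
    rw [hQ]
    exact add_nonneg (mul_nonneg hlam.le huu) (Finset.sum_nonneg fun k _ => sq_nonneg _)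
  have hsum : ∑ k ∈ Finset.range s, (p.consensus x η (k + 1) i - ⟪x (k + 1), θ⟫)
        * (u ⬝ᵥ (x (k + 1)).ofLp)
      = ∑ k ∈ Finset.range s, b k * (u ⬝ᵥ (x (k + 1)).ofLp)
        + ∑ k ∈ Finset.range s, r k * (u ⬝ᵥ (x (k + 1)).ofLp)
        + ∑ k ∈ Finset.range s, n k * (u ⬝ᵥ (x (k + 1)).ofLp) := by
    rw [← Finset.sum_add_distrib, ← Finset.sum_add_distrib]
    refine Finset.sum_congr rfl fun k hk => ?_
    rw [hsplit k (Finset.mem_range.1 hk)]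
    ring
  -- One Cauchy–Schwarz for the regularization term and the errors `b k` jointly: the second factor
  -- `λ ‖u‖² + ∑ ⟪u, x_k⟫²` is `Q` itself, so the two contributions add as squares inside `B₁`.
  have hcs : (p.lam * (u ⬝ᵥ θ.ofLp) + -∑ k ∈ Finset.range s, b k * (u ⬝ᵥ (x (k + 1)).ofLp)) ^ 2
      ≤ (p.lam * ‖θ‖ ^ 2 + ∑ k ∈ Finset.range s, b k ^ 2) * Q := by
    rw [hQ]
    refine sq_add_le_mul_add (by positivity) (mul_nonneg hlam.le huu)
      (Finset.sum_nonneg fun k _ => sq_nonneg _) (Finset.sum_nonneg fun k _ => sq_nonneg _) ?_ ?_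
    · have h := mul_le_mul_of_nonneg_left (sq_dotProduct_le u θ.ofLp) (sq_nonneg p.lam)
      rw [norm_sq_eq_dotProduct]
      linarith
    · rw [neg_sq]
      exact Finset.sum_mul_sq_le_sq_mul_sq _ _ _
  have hcs' : p.lam * (u ⬝ᵥ θ.ofLp) + -∑ k ∈ Finset.range s, b k * (u ⬝ᵥ (x (k + 1)).ofLp)
      ≤ B₁ * Real.sqrt Q := by
    have h1 := Real.abs_le_sqrt (hcs.trans (mul_le_mul_of_nonneg_right hb hQ0))
    rw [Real.sqrt_mul (sq_nonneg _), Real.sqrt_sq hB₁] at h1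
    exact (le_abs_self _).trans h1
  have hfin : Q ≤ (B₂ + B₁ + B₃) * Real.sqrt Q := by
    rw [abs_le] at hn hr
    rw [hsum] at hid
    linarith [hn.1, hr.1]
  rcases (Real.sqrt_nonneg Q).eq_or_lt with h0 | h0
  · rw [← h0]; linarith
  · have h1 := Real.mul_self_sqrt hQ0
    rw [← h1] at hfin
    conv at hfin => rhs; rw [h1]
    exact le_of_mul_le_mul_right hfin h0

/-! ### Consensus errors -/

variable {G : SimpleGraph (Fin N)}

/-- The deviation from `1 / N` of the weight that agent `i` gives to agent `j` in episode `k`. -/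
def coeffError (hG : IsNetwork G p.W) (k : ℕ) (i j : Fin N) : ℝ :=
  mixCoeff hG.isHermitian (p.q k) i j - (N : ℝ)⁻¹

lemma natCast_ne_zero (i : Fin N) : (N : ℝ) ≠ 0 := by
  have := i.pos
  positivity

lemma sum_coeffError (hG : IsNetwork G p.W) (k : ℕ) (i : Fin N) :
    ∑ j, coeffError hG k i j = 0 := by
  have := natCast_ne_zero i
  simp [coeffError, Finset.sum_sub_distrib, hG.sum_mixCoeff, this]

/-- The mixing weight has reached `N k` after `q k` rounds, and `(1 - 1/N) / N ≤ 1/4`. -/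
lemma sum_sq_coeffError_le (hG : IsNetwork G p.W) {k : ℕ} (hk : 1 ≤ k) (i : Fin N) :
    ∑ j, coeffError hG k i j ^ 2 ≤ (N : ℝ)⁻¹ * (1 / 4 * (1 / (k : ℝ) ^ 2)) := by
  have hN : (0 : ℝ) < N := by have := i.pos; positivity
  have hk' : (0 : ℝ) < k := by positivity
  have hmw := le_mixWeight_ceil (K := N * k) hG.secondEig_pos hG.secondEig_lt (by positivity)
  rw [← mul_assoc] at hmw
  change (N : ℝ) * k ≤ mixWeight (secondEig p.W) (p.q k) at hmw
  have hN1 : (N : ℝ)⁻¹ ≤ 1 := inv_le_one_of_one_le₀ (by exact_mod_cast i.pos)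
  calc _ ≤ (1 - (N : ℝ)⁻¹) / mixWeight (secondEig p.W) (p.q k) ^ 2 :=
        hG.sum_sq_mixCoeff_sub _ _
    _ ≤ (1 - (N : ℝ)⁻¹) / (N * k) ^ 2 := by
        have : (0 : ℝ) ≤ 1 - (N : ℝ)⁻¹ := by linarith
        gcongr
    _ = (N : ℝ)⁻¹ * ((1 - (N : ℝ)⁻¹) * (N : ℝ)⁻¹ * (1 / (k : ℝ) ^ 2)) := by field_simp
    _ ≤ _ := by
        gcongr
        nlinarith [sq_nonneg ((N : ℝ)⁻¹ - 1 / 2)]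

lemma consensus_eq (hG : IsNetwork G p.W) (x : ℕ → EuclideanSpace ℝ (Fin d))
    (η : Fin N → ℕ → ℝ) (k : ℕ) (i : Fin N) :
    p.consensus x η k i
      = ∑ j, ((N : ℝ)⁻¹ + coeffError hG k i j) * p.reward x η k j := by
  rw [Problem.consensus, mix_eq_sum hG.isHermitian hG.secondEig_pos hG.secondEig_lt]
  refine Finset.sum_congr rfl fun j _ => ?_
  rw [coeffError, add_sub_cancel]

lemma inner_θglobal (z : EuclideanSpace ℝ (Fin d)) :
    ⟪z, p.θglobal⟫ = ∑ j, (N : ℝ)⁻¹ * ⟪z, p.θ j⟫ := by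
  rw [Problem.θglobal, real_inner_smul_right, inner_sum, Finset.mul_sum]

/-- The observation error with all consensus errors kept together. -/
lemma consensus_sub_inner (hG : IsNetwork G p.W) (x : ℕ → EuclideanSpace ℝ (Fin d))
    (η : Fin N → ℕ → ℝ) (k : ℕ) (i : Fin N) :
    p.consensus x η k i - ⟪x k, p.θglobal⟫
      = ∑ j, coeffError hG k i j * p.reward x η k j
        + ∑ j, (N : ℝ)⁻¹ * η j (p.startRound k) := by
  rw [consensus_eq hG, inner_θglobal, ← Finset.sum_sub_distrib, ← Finset.sum_add_distrib]
  refine Finset.sum_congr rfl fun j _ => ?_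
  rw [Problem.reward]
  ring

/-- The observation error with the bias separated from the noise. -/
lemma consensus_sub_inner' (hG : IsNetwork G p.W) (x : ℕ → EuclideanSpace ℝ (Fin d))
    (η : Fin N → ℕ → ℝ) (k : ℕ) (i : Fin N) :
    p.consensus x η k i - ⟪x k, p.θglobal⟫
      = ∑ j, coeffError hG k i j * ⟪x k, p.θ j - p.θglobal⟫
        + ∑ j, ((N : ℝ)⁻¹ + coeffError hG k i j) * η j (p.startRound k) := by
  have h0 : ∑ j, coeffError hG k i j * ⟪x k, p.θglobal⟫ = 0 := by
    rw [← Finset.sum_mul, sum_coeffError, zero_mul]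
  rw [consensus_eq hG]
  simp only [inner_sub_right, mul_sub, Finset.sum_sub_distrib, h0, sub_zero]
  rw [inner_θglobal, ← Finset.sum_sub_distrib, ← Finset.sum_add_distrib]
  refine Finset.sum_congr rfl fun j _ => ?_
  rw [Problem.reward]
  ring

lemma sq_sum_coeffError_mul_le (hG : IsNetwork G p.W) {k : ℕ} (hk : 1 ≤ k) (i : Fin N)
    {v : Fin N → ℝ} {c : ℝ} (hv : ∑ j, v j ^ 2 ≤ N * c) :
    (∑ j, coeffError hG k i j * v j) ^ 2 ≤ c * (1 / 4 * (1 / (k : ℝ) ^ 2)) := by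
  have hN := natCast_ne_zero i
  refine (Finset.sum_mul_sq_le_sq_mul_sq _ _ _).trans ?_
  calc _ ≤ ((N : ℝ)⁻¹ * (1 / 4 * (1 / (k : ℝ) ^ 2))) * (N * c) :=
        mul_le_mul (sum_sq_coeffError_le hG hk i) hv (Finset.sum_nonneg fun j _ => sq_nonneg _)
          (by positivity)
    _ = _ := by field_simp

lemma sum_sq_reward_le {x : ℕ → EuclideanSpace ℝ (Fin d)} {η : Fin N → ℕ → ℝ} {k : ℕ}
    (h : ∀ i, |p.reward x η k i| ≤ 1) : ∑ j, p.reward x η k j ^ 2 ≤ N * 1 := by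
  calc _ ≤ ∑ _j : Fin N, (1 : ℝ) :=
        Finset.sum_le_sum fun j _ => (sq_le_one_iff_abs_le_one _).2 (h j)
    _ = _ := by simp

/-- The variance identity. It leaves the slack `S² - ‖θglobal‖²` that pays for the consensus bias.
-/
lemma sum_norm_sub_θglobal_sq (i : Fin N) :
    ∑ j, ‖p.θ j - p.θglobal‖ ^ 2 = ∑ j, ‖p.θ j‖ ^ 2 - N * ‖p.θglobal‖ ^ 2 := by
  have hN := natCast_ne_zero i
  have h1 : ∑ j, p.θ j = (N : ℝ) • p.θglobal := by
    rw [Problem.θglobal, smul_smul, mul_inv_cancel₀ hN, one_smul]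
  have h2 : ∑ j, ⟪p.θ j, p.θglobal⟫ = N * ‖p.θglobal‖ ^ 2 := by
    rw [← sum_inner, h1, real_inner_smul_left, real_inner_self_eq_norm_sq]
  simp only [norm_sub_sq_real, Finset.sum_add_distrib, Finset.sum_sub_distrib, ← Finset.mul_sum, h2]
  simp
  ring

variable {xstar : EuclideanSpace ℝ (Fin d)}

lemma sum_norm_sub_θglobal_sq_le (hp : Admissible p xstar) (i : Fin N) :
    ∑ j, ‖p.θ j - p.θglobal‖ ^ 2 ≤ N * (p.S ^ 2 - ‖p.θglobal‖ ^ 2) := by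
  rw [sum_norm_sub_θglobal_sq i, mul_sub]
  have : ∑ j, ‖p.θ j‖ ^ 2 ≤ ∑ _j : Fin N, p.S ^ 2 := Finset.sum_le_sum fun j _ => by
    have := hp.param_le j
    gcongr
  simp at this
  linarith

lemma norm_θglobal_sq_le (hp : Admissible p xstar) (i : Fin N) : ‖p.θglobal‖ ^ 2 ≤ p.S ^ 2 := by
  have h := sum_norm_sub_θglobal_sq_le hp i
  have h0 : 0 ≤ ∑ j, ‖p.θ j - p.θglobal‖ ^ 2 := Finset.sum_nonneg fun j _ => sq_nonneg _
  have hN : (0 : ℝ) < N := by have := i.pos; positivity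
  have := (mul_nonneg_iff_of_pos_left hN).1 (h0.trans h)
  linarith

/-! ### The two regimes of the confidence radius -/

/-- The summand `1 / (k + 1)²`, with the first one removed. -/
def tailSq (k : ℕ) : ℝ := if k = 0 then 0 else 1 / ((k + 1 : ℕ) : ℝ) ^ 2

lemma tailSq_nonneg (k : ℕ) : 0 ≤ tailSq k := by
  unfold tailSq
  split_ifs <;> positivity

/-- Telescoping from `1/m² ≤ 1/(m-1) - 1/m` for `m ≥ 2`. -/
lemma sum_tailSq_le_one (s : ℕ) : ∑ k ∈ Finset.range s, tailSq k ≤ 1 := by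
  have key : ∀ n : ℕ, ∑ k ∈ Finset.range (n + 1), tailSq k ≤ 1 - 1 / ((n : ℝ) + 1) := by
    intro n
    induction n with
    | zero => simp [tailSq]
    | succ n ih =>
      rw [Finset.sum_range_succ]
      have h : tailSq (n + 1) ≤ 1 / ((n : ℝ) + 1) - 1 / ((n : ℝ) + 1 + 1) := by
        rw [tailSq, if_neg (Nat.succ_ne_zero n), div_sub_div _ _ (by positivity) (by positivity),
          div_le_div_iff₀ (by positivity) (by positivity)]
        push_cast
        nlinarith [(Nat.cast_nonneg n : (0 : ℝ) ≤ n)]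
      push_cast
      linarith
  rcases s with _ | n
  · simp
  · refine (key n).trans ?_
    have : (0 : ℝ) ≤ 1 / ((n : ℝ) + 1) := by positivity
    linarith

/-- The coefficient of `√(gram)` coming from the noise in the confidence radius. -/
def noiseRadius (p : Problem N d) (s : ℕ) : ℝ :=
  p.R / Real.sqrt N *
    Real.sqrt (d * Real.log ((1 + s * p.L ^ 2 / p.lam) / (p.δ / (2 * N))))

lemma noiseRadius_nonneg (hp : Admissible p xstar) (s : ℕ) : 0 ≤ noiseRadius p s := by
  have := hp.R_nonneg
  unfold noiseRadius
  positivity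

lemma S_nonneg (hp : Admissible p xstar) (i : Fin N) : 0 ≤ p.S :=
  (norm_nonneg _).trans (hp.param_le i)

lemma sq_sqrt_mul_add_div_sqrt (hp : Admissible p xstar) (i : Fin N) :
    p.lam * p.S ^ 2 + p.L ^ 2 / p.lam
      ≤ (Real.sqrt p.lam * p.S + p.L / Real.sqrt p.lam) ^ 2 := by
  have hS := S_nonneg hp i
  have hl := hp.lam_pos
  have hL := hp.L_pos
  have h1 : (Real.sqrt p.lam * p.S) ^ 2 = p.lam * p.S ^ 2 := by rw [mul_pow, Real.sq_sqrt hl.le]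
  have h2 : (p.L / Real.sqrt p.lam) ^ 2 = p.L ^ 2 / p.lam := by rw [div_pow, Real.sq_sqrt hl.le]
  rw [← h1, ← h2, add_sq]
  have : 0 ≤ 2 * (Real.sqrt p.lam * p.S) * (p.L / Real.sqrt p.lam) := by positivity
  linarith

/-- Noise weights of agent `i` in episode `k + 1`. -/
def noiseWeight (hG : IsNetwork G p.W) (i : Fin N) (k : ℕ) (j : Fin N) : ℝ :=
  (N : ℝ)⁻¹ + if k = 0 ∨ p.lam ≤ p.L ^ 2 then 0 else coeffError hG (k + 1) i j

/-- The relative excess of the variance proxy of the weighted noise. -/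
def noiseExcess (p : Problem N d) (k : ℕ) : ℝ :=
  if p.lam ≤ p.L ^ 2 then 0 else 1 / 4 * tailSq k

/-- If the weighted noise is controlled, then the global parameter lies in the ellipsoid. -/
lemma θglobal_mem_ellipsoid (hG : IsNetwork G p.W) (hp : Admissible p xstar)
    {x : ℕ → EuclideanSpace ℝ (Fin d)} {η : Fin N → ℕ → ℝ} {s : ℕ} {i : Fin N}
    (hrew : ∀ k < s, ∀ j, |p.reward x η (k + 1) j| ≤ 1) (hx : ∀ k < s, ‖x (k + 1)‖ ≤ p.L)
    (hn : ∀ u : Fin d → ℝ, |∑ k ∈ Finset.range s,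
        (∑ j, noiseWeight hG i k j * η j (p.startRound (k + 1))) * (u ⬝ᵥ (x (k + 1)).ofLp)|
      ≤ noiseRadius p s * Real.sqrt (u ⬝ᵥ (p.gram x s *ᵥ u))) :
    p.θglobal ∈ p.ellipsoid x η s i := by
  have hl := hp.lam_pos
  have hL := hp.L_pos
  have hS := S_nonneg hp i
  have hθ := norm_θglobal_sq_le hp i
  have hR := noiseRadius_nonneg hp s
  have hLl : 0 ≤ p.L / Real.sqrt p.lam := by positivity
  change weightedNorm _ _ ≤ _
  have hβ : p.β s = noiseRadius p s + Real.sqrt p.lam * p.S + p.L / Real.sqrt p.lam := rfl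
  rw [hβ]
  set e : ℕ → ℝ := fun k => ∑ j, coeffError hG (k + 1) i j * p.reward x η (k + 1) j
  have he : ∀ k < s, e k ^ 2 ≤ 1 / 4 * (1 / ((k + 1 : ℕ) : ℝ) ^ 2) := fun k hk => by
    have := sq_sum_coeffError_mul_le hG (Nat.le_add_left 1 k) i (sum_sq_reward_le (hrew k hk))
    rwa [one_mul] at this
  by_cases hcase : p.lam ≤ p.L ^ 2
  -- Regime `λ ≤ L²`: since rewards are at most 1, the squared consensus errors sum to at most
  -- `(1/4)(1 + 1) ≤ 1 ≤ L²/λ`. They join the regularization term, and the noise left is the plain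
  -- average.
  · have hw : ∀ k j, noiseWeight hG i k j = (N : ℝ)⁻¹ := fun k j => by
      simp [noiseWeight, hcase]
    have hb : p.lam * ‖p.θglobal‖ ^ 2 + ∑ k ∈ Finset.range s, e k ^ 2
        ≤ (Real.sqrt p.lam * p.S + p.L / Real.sqrt p.lam) ^ 2 := by
      refine le_trans ?_ (sq_sqrt_mul_add_div_sqrt hp i)
      refine add_le_add (mul_le_mul_of_nonneg_left hθ hl.le) ?_
      have h1 : (1 : ℝ) ≤ p.L ^ 2 / p.lam := by rwa [le_div_iff₀ hl, one_mul]
      refine le_trans ?_ h1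
      have h2 : ∀ k ∈ Finset.range s, e k ^ 2 ≤ 1 / 4 * (tailSq k + if k = 0 then 1 else 0) := by
        intro k hk
        refine (he k (Finset.mem_range.1 hk)).trans_eq ?_
        by_cases hk0 : k = 0 <;> simp [tailSq, hk0]
      refine (Finset.sum_le_sum h2).trans ?_
      rw [← Finset.mul_sum, Finset.sum_add_distrib]
      have h3 : ∑ k ∈ Finset.range s, (if k = 0 then (1 : ℝ) else 0) ≤ 1 := by
        rw [Finset.sum_ite_eq']
        split_ifs <;> norm_num
      linarith [sum_tailSq_le_one s]
    have h := weightedNorm_sub_estimate_le hl (x := x) (η := η) (s := s) (i := i) (b := e)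
      (r := fun _ => 0) (n := fun k => ∑ j, noiseWeight hG i k j * η j (p.startRound (k + 1)))
      (B₃ := 0) (fun k hk => by
        simp only [hw]
        rw [consensus_sub_inner hG, add_zero]) (by positivity) hb hn (fun u => by simp)
      (by linarith)
    linarith
  -- Regime `λ > L²`: now `L²/λ` may be too small for all the errors. Only the first episode keeps
  -- its error in reward form, as `r`, and uses up `L/√λ`; later episodes are split into the bias
  -- `b` and reweighted noise.
  · have hlt := not_le.1 hcase
    set b : ℕ → ℝ := fun k => if k = 0 then 0 else
      ∑ j, coeffError hG (k + 1) i j * ⟪x (k + 1), p.θ j - p.θglobal⟫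
    have hsplit : ∀ k < s, p.consensus x η (k + 1) i - ⟪x (k + 1), p.θglobal⟫
        = b k + (if k = 0 then e k else 0)
          + ∑ j, noiseWeight hG i k j * η j (p.startRound (k + 1)) := by
      intro k hk
      by_cases hk0 : k = 0
      · subst hk0
        have hw : ∀ j, noiseWeight hG i 0 j = (N : ℝ)⁻¹ := fun j => by simp [noiseWeight]
        simp only [hw, b, if_true, zero_add]
        exact consensus_sub_inner hG x η 1 i
      · have hw : ∀ j, noiseWeight hG i k j = (N : ℝ)⁻¹ + coeffError hG (k + 1) i j := fun j => by
          simp [noiseWeight, hk0, hcase]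
        simp only [hw, b, hk0, if_false, add_zero]
        exact consensus_sub_inner' hG x η _ i
    have hb : p.lam * ‖p.θglobal‖ ^ 2 + ∑ k ∈ Finset.range s, b k ^ 2
        ≤ (Real.sqrt p.lam * p.S) ^ 2 := by
      have hD : 0 ≤ p.S ^ 2 - ‖p.θglobal‖ ^ 2 := by linarith
      have h2 : ∀ k ∈ Finset.range s,
          b k ^ 2 ≤ p.lam * (p.S ^ 2 - ‖p.θglobal‖ ^ 2) * tailSq k := by
        intro k hk
        by_cases hk0 : k = 0
        · simp [b, hk0, tailSq]
        · have hv : ∑ j, ⟪x (k + 1), p.θ j - p.θglobal⟫ ^ 2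
              ≤ N * (p.L ^ 2 * (p.S ^ 2 - ‖p.θglobal‖ ^ 2)) := by
            calc _ ≤ ∑ j, p.L ^ 2 * ‖p.θ j - p.θglobal‖ ^ 2 := by
                  refine Finset.sum_le_sum fun j _ => ?_
                  rw [← mul_pow]
                  refine sq_le_sq' ?_ ?_
                  · have h1 := abs_real_inner_le_norm (x (k + 1)) (p.θ j - p.θglobal)
                    have h2 := mul_le_mul_of_nonneg_right (hx k (Finset.mem_range.1 hk))
                      (norm_nonneg (p.θ j - p.θglobal))
                    linarith [(abs_le.1 h1).1]
                  · exact (real_inner_le_norm _ _).trans (mul_le_mul_of_nonneg_right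
                      (hx k (Finset.mem_range.1 hk)) (norm_nonneg _))
              _ ≤ p.L ^ 2 * (N * (p.S ^ 2 - ‖p.θglobal‖ ^ 2)) := by
                  rw [← Finset.mul_sum]
                  exact mul_le_mul_of_nonneg_left (sum_norm_sub_θglobal_sq_le hp i) (sq_nonneg _)
              _ = _ := by ring
          have h3 := sq_sum_coeffError_mul_le hG (Nat.le_add_left 1 k) i hv
          simp only [b, hk0, if_false, tailSq]
          refine h3.trans ?_
          have hq : (0 : ℝ) ≤ 1 / ((k + 1 : ℕ) : ℝ) ^ 2 := by positivity
          have h4 : p.L ^ 2 * (p.S ^ 2 - ‖p.θglobal‖ ^ 2) * (1 / 4)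
              ≤ p.lam * (p.S ^ 2 - ‖p.θglobal‖ ^ 2) := by nlinarith
          calc _ = p.L ^ 2 * (p.S ^ 2 - ‖p.θglobal‖ ^ 2) * (1 / 4)
                * (1 / ((k + 1 : ℕ) : ℝ) ^ 2) := by ring
            _ ≤ _ := mul_le_mul_of_nonneg_right h4 hq
      have h3 := Finset.sum_le_sum h2
      rw [← Finset.mul_sum] at h3
      have h4 : p.lam * (p.S ^ 2 - ‖p.θglobal‖ ^ 2) * ∑ k ∈ Finset.range s, tailSq k
          ≤ p.lam * (p.S ^ 2 - ‖p.θglobal‖ ^ 2) :=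
        mul_le_of_le_one_right (by positivity) (sum_tailSq_le_one s)
      rw [mul_pow, Real.sq_sqrt hl.le]
      linarith
    have hr : ∀ u : Fin d → ℝ,
        |∑ k ∈ Finset.range s, (if k = 0 then e k else 0) * (u ⬝ᵥ (x (k + 1)).ofLp)|
        ≤ p.L / Real.sqrt p.lam * Real.sqrt (u ⬝ᵥ (p.gram x s *ᵥ u)) := by
      intro u
      simp only [ite_mul, zero_mul, Finset.sum_ite_eq']
      split_ifs with h0
      · have hs0 := Finset.mem_range.1 h0
        have he0 := he 0 hs0
        norm_num at he0
        have hQ := regGram_quadratic p.lam (fun k => (x (k + 1)).ofLp) s u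
        rw [← gram_eq_regGram] at hQ
        have hQl : p.lam * (u ⬝ᵥ u) ≤ u ⬝ᵥ (p.gram x s *ᵥ u) := by
          rw [hQ]
          exact le_add_of_nonneg_right (Finset.sum_nonneg fun k _ => sq_nonneg _)
        have hux : (u ⬝ᵥ (x (0 + 1)).ofLp) ^ 2 ≤ (u ⬝ᵥ u) * p.L ^ 2 := by
          refine (sq_dotProduct_le _ _).trans (mul_le_mul_of_nonneg_left ?_
            (dotProduct_self_nonneg' u))
          rw [← norm_sq_eq_dotProduct]
          have := hx 0 hs0
          gcongr
        rw [← Real.sqrt_sq hLl, ← Real.sqrt_mul (sq_nonneg _), div_pow, Real.sq_sqrt hl.le]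
        refine Real.abs_le_sqrt ?_
        have hu0 := dotProduct_self_nonneg' u
        calc (e 0 * (u ⬝ᵥ (x (0 + 1)).ofLp)) ^ 2
            = e 0 ^ 2 * (u ⬝ᵥ (x (0 + 1)).ofLp) ^ 2 := mul_pow _ _ _
          _ ≤ 1 * ((u ⬝ᵥ u) * p.L ^ 2) :=
              mul_le_mul (by linarith) hux (sq_nonneg _) zero_le_one
          _ = p.L ^ 2 / p.lam * (p.lam * (u ⬝ᵥ u)) := by field_simp
          _ ≤ _ := mul_le_mul_of_nonneg_left hQl (by positivity)
      · rw [abs_zero]; positivity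
    have h := weightedNorm_sub_estimate_le hl hsplit (by positivity) hb hn hr (by linarith)
    linarith

end Deterministic

/-! ### Optimism and safety on the good event -/

section SafeSets

variable {N d : ℕ} {p : Problem N d} {xstar : EuclideanSpace ℝ (Fin d)}

lemma lambdaMin_mul_le {A : Matrix (Fin d) (Fin d) ℝ} (hA : A.IsHermitian) (v : Fin d → ℝ) :
    lambdaMin A * (v ⬝ᵥ v) ≤ v ⬝ᵥ (A *ᵥ v) := by
  have hpars : ∀ x y : Fin d → ℝ, x ⬝ᵥ y
      = ∑ m, ((hA.eigenvectorBasis m).ofLp ⬝ᵥ x) * ((hA.eigenvectorBasis m).ofLp ⬝ᵥ y) := by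
    intro x y
    have h := hA.eigenvectorBasis.sum_inner_mul_inner (WithLp.toLp 2 x) (WithLp.toLp 2 y)
    simp only [inner_eq_dotProduct] at h
    rw [← h]
    exact Finset.sum_congr rfl fun m _ => by rw [dotProduct_comm x]
  rw [hpars v v, hpars v (A *ᵥ v), Finset.mul_sum]
  refine Finset.sum_le_sum fun m _ => ?_
  have h1 : (hA.eigenvectorBasis m).ofLp ⬝ᵥ (A *ᵥ v)
      = hA.eigenvalues m * ((hA.eigenvectorBasis m).ofLp ⬝ᵥ v) := by
    rw [Matrix.dotProduct_mulVec, vecMul_eigenvectorBasis, smul_dotProduct, smul_eq_mul]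
  have h2 : lambdaMin A ≤ hA.eigenvalues m :=
    csInf_le (Matrix.finite_real_spectrum (A := A)).bddBelow (hA.eigenvalues_mem_spectrum_real m)
  rw [h1]
  nlinarith [mul_self_nonneg ((hA.eigenvectorBasis m).ofLp ⬝ᵥ v)]

lemma β_pos (hp : Admissible p xstar) (i : Fin N) (s : ℕ) : 0 < p.β s := by
  have h1 := noiseRadius_nonneg hp s
  have h2 := S_nonneg hp i
  have h3 := hp.lam_pos
  have h4 := hp.L_pos
  have h5 : 0 < p.L / Real.sqrt p.lam := by positivity
  have h6 : 0 ≤ Real.sqrt p.lam * p.S := by positivity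
  have h7 : p.β s = noiseRadius p s + Real.sqrt p.lam * p.S + p.L / Real.sqrt p.lam := rfl
  rw [h7]
  linarith

lemma gram_posDef (hp : Admissible p xstar) (x : ℕ → EuclideanSpace ℝ (Fin d)) (s : ℕ) :
    (p.gram x s).PosDef := by
  rw [gram_eq_regGram]
  exact regGram_posDef hp.lam_pos _ _

lemma ellipsoid_quadratic_le {x : ℕ → EuclideanSpace ℝ (Fin d)} {η : Fin N → ℕ → ℝ} {s : ℕ}
    {i : Fin N} {v : EuclideanSpace ℝ (Fin d)} (hv : v ∈ p.ellipsoid x η s i) :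
    (v - p.estimate x η s i).ofLp ⬝ᵥ (p.gram x s *ᵥ (v - p.estimate x η s i).ofLp)
      ≤ p.β s ^ 2 :=
  (Real.sqrt_le_iff.1 hv).2

lemma isClosed_ellipsoid (x : ℕ → EuclideanSpace ℝ (Fin d)) (η : Fin N → ℕ → ℝ) (s : ℕ)
    (i : Fin N) : IsClosed (p.ellipsoid x η s i) := by
  refine isClosed_le ?_ continuous_const
  simp only [weightedNorm, dotProduct, Matrix.mulVec]
  fun_prop

lemma isCompact_ellipsoid (hp : Admissible p xstar) (x : ℕ → EuclideanSpace ℝ (Fin d))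
    (η : Fin N → ℕ → ℝ) (s : ℕ) (i : Fin N) : IsCompact (p.ellipsoid x η s i) := by
  refine Metric.isCompact_of_isClosed_isBounded (isClosed_ellipsoid x η s i) ?_
  refine (Metric.isBounded_closedBall (x := p.estimate x η s i)
    (r := p.β s / Real.sqrt p.lam)).subset fun v hv => ?_
  have hl := hp.lam_pos
  have h1 := ellipsoid_quadratic_le hv
  rw [gram_eq_regGram, regGram_quadratic, ← norm_sq_eq_dotProduct] at h1
  have h2 : p.lam * ‖v - p.estimate x η s i‖ ^ 2 ≤ p.β s ^ 2 :=
    le_trans (le_add_of_nonneg_right (Finset.sum_nonneg fun k _ => sq_nonneg _)) h1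
  rw [Metric.mem_closedBall, dist_eq_norm, le_div_iff₀ (Real.sqrt_pos.2 hl)]
  refine le_of_sq_le_sq ?_ (β_pos hp i s).le
  rw [mul_pow, Real.sq_sqrt hl.le]
  linarith

lemma isCompact_safeSet (hp : Admissible p xstar) (x : ℕ → EuclideanSpace ℝ (Fin d))
    (η : Fin N → ℕ → ℝ) (s : ℕ) (i : Fin N) : IsCompact (p.safeSet x η s i) := by
  have h : p.safeSet x η s i = p.X ∩ ⋂ v ∈ p.ellipsoid x η (s - 1) i,
      {z | (1 - p.α) * p.rb (p.startRound s) ≤ ⟪z, v⟫} := by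
    ext z
    simp [Problem.safeSet]
  rw [h]
  refine hp.compact.inter_right (isClosed_biInter fun v _ => ?_)
  exact isClosed_le continuous_const (by fun_prop)

/-- Enough exploration makes the optimal action safe. -/
lemma xstar_mem_safeSet (hp : Admissible p xstar) {x : ℕ → EuclideanSpace ℝ (Fin d)}
    {η : Fin N → ℕ → ℝ} {s : ℕ} {i : Fin N} (hs : p.startRound s ∈ Finset.Icc 1 p.T)
    (hθ : p.θglobal ∈ p.ellipsoid x η (s - 1) i)
    (hthr : p.threshold s ≤ lambdaMin (p.gram x (s - 1))) :
    xstar ∈ p.safeSet x η s i := by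
  refine ⟨hp.xstar_mem, fun v hv => ?_⟩
  have hβ := β_pos hp i (s - 1)
  have hL := hp.L_pos
  have hκ : 0 < p.κl + p.α * p.rl :=
    add_pos_of_nonneg_of_pos hp.κl_nonneg (mul_pos hp.α_pos hp.rl_pos)
  -- By the threshold on `λ_min`, each point of the ellipsoid uses at most half of the margin `κl +
  -- α rl` relative to the centre.
  have hnorm : ∀ v ∈ p.ellipsoid x η (s - 1) i,
      2 * p.L * ‖v - p.estimate x η (s - 1) i‖ ≤ p.κl + p.α * p.rl := by
    intro v hv
    have h1 := ellipsoid_quadratic_le hv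
    have h2 := lambdaMin_mul_le (gram_posDef hp x (s - 1)).isHermitian
      (v - p.estimate x η (s - 1) i).ofLp
    rw [← norm_sq_eq_dotProduct] at h2
    have h3 := mul_le_mul_of_nonneg_right hthr (sq_nonneg ‖v - p.estimate x η (s - 1) i‖)
    have h4 := h3.trans (h2.trans h1)
    rw [Problem.threshold, ← mul_pow] at h4
    have h5 := le_of_sq_le_sq h4 hβ.le
    rw [div_mul_eq_mul_div, div_le_iff₀ hκ] at h5
    refine le_of_mul_le_mul_left ?_ hβ
    linarith
  have hdist : p.L * ‖p.θglobal - v‖ ≤ p.κl + p.α * p.rl := by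
    have h1 := hnorm _ hθ
    have h2 := hnorm _ hv
    have h3 : ‖p.θglobal - v‖ ≤ ‖p.θglobal - p.estimate x η (s - 1) i‖
        + ‖v - p.estimate x η (s - 1) i‖ := by
      rw [← sub_sub_sub_cancel_right p.θglobal v (p.estimate x η (s - 1) i)]
      exact norm_sub_le _ _
    have h4 := mul_le_mul_of_nonneg_left h3 hL.le
    linarith
  have hin : ⟪xstar, p.θglobal - v⟫ ≤ p.κl + p.α * p.rl :=
    (real_inner_le_norm _ _).trans ((mul_le_mul_of_nonneg_right
      (hp.action_le _ hp.xstar_mem) (norm_nonneg _)).trans hdist)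
  rw [inner_sub_right] at hin
  -- The optimal reward exceeds `rb` by at least `κl`, and `α rl ≤ α rb`, so losing `κl + α rl`
  -- still leaves `(1 - α) rb`.
  have hgap := (hp.gap _ hs).1
  have hrb := mul_le_mul_of_nonneg_left (hp.baseline_reward _ hs).1 hp.α_pos.le
  linarith

lemma exists_isUCB (hp : Admissible p xstar) {x : ℕ → EuclideanSpace ℝ (Fin d)}
    {η : Fin N → ℕ → ℝ} {s : ℕ} {i : Fin N} (hsafe : (p.safeSet x η s i).Nonempty)
    (hell : (p.ellipsoid x η (s - 1) i).Nonempty) : ∃ z v, p.IsUCB x η s i z v := by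
  obtain ⟨⟨z, v⟩, ⟨hz, hv⟩, hmax⟩ :=
    ((isCompact_safeSet hp x η s i).prod (isCompact_ellipsoid hp x η (s - 1) i)).exists_isMaxOn
      (hsafe.prod hell) (f := fun y => ⟪y.1, y.2⟫)
      (Continuous.continuousOn (continuous_fst.inner continuous_snd))
  exact ⟨z, v, hz, hv, fun z' hz' v' hv' => hmax (Set.mk_mem_prod hz' hv')⟩

end SafeSets

/-! ### The schedule of the episodes -/

section Schedule

variable {N d : ℕ} {p : Problem N d}

lemma one_le_startRound (s : ℕ) : 1 ≤ p.startRound s := Nat.le_add_right _ _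

lemma startRound_succ {s : ℕ} (hs : 1 ≤ s) :
    p.startRound (s + 1) = p.startRound s + (1 + p.q s) := by
  rw [Problem.startRound, Problem.startRound, Finset.sum_Ico_succ_top hs, add_assoc]

lemma startRound_add_q_lt {j k : ℕ} (hj : 1 ≤ j) (hjk : j < k) :
    p.startRound j + p.q j < p.startRound k := by
  induction k, hjk using Nat.le_induction with
  | base => rw [startRound_succ hj]; omega
  | succ k hk ih => rw [startRound_succ (by omega)]; omega

/-- Episodes end in increasing order, so if episode `s` started after `T`, at most `s - 1` episodes
would be counted. -/
lemma startRound_mem_Icc {s : ℕ} (hs : s ∈ Finset.Icc 1 p.numEpisodes) :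
    p.startRound s ∈ Finset.Icc 1 p.T := by
  obtain ⟨hs1, hsM⟩ := Finset.mem_Icc.1 hs
  refine Finset.mem_Icc.2 ⟨one_le_startRound s, ?_⟩
  by_contra! hlt
  have hsub : ((Finset.Icc 1 p.T).filter fun s => p.startRound s + p.q s ≤ p.T)
      ⊆ Finset.Icc 1 (s - 1) := by
    intro k hk
    obtain ⟨hk1, hk2⟩ := Finset.mem_filter.1 hk
    have h1 := (Finset.mem_Icc.1 hk1).1
    refine Finset.mem_Icc.2 ⟨h1, ?_⟩
    by_contra! hks
    rcases (show s ≤ k by omega).eq_or_lt with rfl | hsk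
    · omega
    · have := startRound_add_q_lt (p := p) hs1 hsk
      omega
  have := Finset.card_le_card hsub
  rw [Nat.card_Icc] at this
  change p.numEpisodes ≤ _ at this
  omega

end Schedule

/-! ### Noise along a run -/

section Run

variable {Ω : Type*} {mΩ : MeasurableSpace Ω} {P : Measure Ω} {N d : ℕ} {p : Problem N d}
  {G : SimpleGraph (Fin N)} {xstar : EuclideanSpace ℝ (Fin d)} {ℱ : Filtration ℕ mΩ}
  {a : ℕ → Ω → Fin N} {ζ : ℕ → Ω → EuclideanSpace ℝ (Fin d)} {η : Fin N → ℕ → Ω → ℝ}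
  {x : ℕ → Ω → EuclideanSpace ℝ (Fin d)}

lemma IsRun.info_le (hrun : IsRun p P ℱ a ζ η x) {t : ℕ} (ht : t ∈ Finset.Icc 1 p.T) :
    info ℱ a ζ t ≤ ℱ t :=
  sup_le (sup_le (ℱ.mono (Nat.sub_le t 1)) (hrun.agent_meas t ht).comap_le)
    (hrun.dir_meas t ht).comap_le

lemma filtration_le_info {j t : ℕ} (h : j < t) : ℱ j ≤ info ℱ a ζ t :=
  (ℱ.mono (by omega)).trans (le_sup_left.trans le_sup_left)

/-- The coefficient errors sum to zero, so there is no cross term and the variance grows only by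
their squares. -/
lemma sum_sq_noiseWeight_le (hG : IsNetwork G p.W) (i : Fin N) (k : ℕ) :
    ∑ j, noiseWeight hG i k j ^ 2 ≤ (N : ℝ)⁻¹ * (1 + noiseExcess p k) := by
  have hN := natCast_ne_zero i
  by_cases h : k = 0 ∨ p.lam ≤ p.L ^ 2
  · have h0 : noiseExcess p k = 0 := by
      rcases h with rfl | h
      · simp [noiseExcess, tailSq]
      · simp [noiseExcess, h]
    simp only [noiseWeight, if_pos h, h0, add_zero]
    simp
    field_simp
    rfl
  · simp only [noiseWeight, if_neg h, add_sq, Finset.sum_add_distrib]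
    rw [← Finset.mul_sum, sum_coeffError]
    have h1 := sum_sq_coeffError_le hG (Nat.le_add_left 1 k) i
    push Not at h
    have h2 : noiseExcess p k = 1 / 4 * (1 / ((k + 1 : ℕ) : ℝ) ^ 2) := by
      simp [noiseExcess, tailSq, h.1, not_le.2 h.2]
    rw [h2, mul_add]
    have h3 : ∑ _j : Fin N, ((N : ℝ)⁻¹) ^ 2 = (N : ℝ)⁻¹ := by
      simp
      field_simp
    rw [h3]
    linarith

/-- The weighted noise of one agent is controlled with probability `1 - δ / (2 N)`. -/
lemma IsRun.measure_noise_gt_le [IsProbabilityMeasure P] (hd : 2 ≤ d) (hG : IsNetwork G p.W)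
    (hp : Admissible p xstar) (hrun : IsRun p P ℱ a ζ η x) (i : Fin N) :
    P {ω | ∃ s ≤ p.numEpisodes, ∃ u : Fin d → ℝ,
        noiseRadius p s * Real.sqrt (u ⬝ᵥ (p.gram (fun k => x k ω) s *ᵥ u))
        < |∑ k ∈ Finset.range s, (∑ j, noiseWeight hG i k j * η j (p.startRound (k + 1)) ω)
          * (u ⬝ᵥ (x (k + 1) ω).ofLp)|} ≤ ENNReal.ofReal (p.δ / (2 * N)) := by
  have hN : (1 : ℝ) ≤ N := by exact_mod_cast i.pos
  have hl := hp.lam_pos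
  have hδ := hp.δ_pos
  set t : ℕ → ℕ := fun k => p.startRound (k + 1) with ht
  have hep : ∀ k < p.numEpisodes, k + 1 ∈ Finset.Icc 1 p.numEpisodes := fun k hk =>
    Finset.mem_Icc.2 ⟨Nat.le_add_left 1 k, hk⟩
  have htT : ∀ k < p.numEpisodes, t k ∈ Finset.Icc 1 p.T := fun k hk =>
    startRound_mem_Icc (hep k hk)
  have hinfo : ∀ k < p.numEpisodes, info ℱ a ζ (t k) ≤ mΩ := fun k hk =>
    (hrun.info_le (htT k hk)).trans (ℱ.le _)
  have hpast : ∀ j k, j < k → ℱ (t j) ≤ info ℱ a ζ (t k) := fun j k hjk =>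
    filtration_le_info (lt_of_le_of_lt (Nat.le_add_right _ _)
      (startRound_add_q_lt (p := p) (Nat.le_add_left 1 j) (Nat.succ_lt_succ hjk)))
  have hηm : ∀ k < p.numEpisodes, ∀ j, Measurable[ℱ (t k)] (η j (t k)) := fun k hk j =>
    hrun.noise_meas _ (htT k hk) j
  have hηm' : ∀ k < p.numEpisodes, ∀ j, Measurable[mΩ] (η j (t k)) := fun k hk j =>
    (hηm k hk j).mono (ℱ.le _) le_rfl
  rcases hp.R_nonneg.eq_or_lt with hR | hR
  -- For `R = 0` the normalization by `R / √N` is unavailable, but the noise vanishes almost surely.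
  · have hzero : ∀ᵐ ω ∂P, ∀ k, k < p.numEpisodes → ∀ j, η j (t k) ω = 0 := by
      refine ae_all_iff.2 fun k => ?_
      by_cases hk : k < p.numEpisodes
      · have h1 : ∀ᵐ ω ∂P, ∀ j, η j (t k) ω = 0 := ae_all_iff.2 fun j => by
          have := hrun.noise_subGaussian _ (htT k hk) j
          rw [← hR] at this
          exact this.ae_eq_zero (hinfo k hk)
        filter_upwards [h1] with ω hω _ using hω
      · exact ae_of_all _ fun ω h => absurd h hk
    refine le_of_eq_of_le (measure_mono_null ?_ (ae_iff.1 hzero)) zero_le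
    rintro ω ⟨s, hs, u, hlt⟩ hω
    rw [Finset.sum_eq_zero fun k hk => by
      rw [Finset.sum_eq_zero fun j _ => by
        have := hω k (by have := Finset.mem_range.1 hk; omega) j
        simp only [ht] at this
        rw [this, mul_zero], zero_mul], abs_zero] at hlt
    exact absurd hlt (not_lt.2 (mul_nonneg (noiseRadius_nonneg hp s) (Real.sqrt_nonneg _)))
  -- `V` bounds the total variance excess, and `λ - L² V` is the lowered regularizer.
  · set V : ℝ := if p.lam ≤ p.L ^ 2 then 0 else 1 / 4 with hVdef
    have hς : 0 < p.R / Real.sqrt N := by positivity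
    have hν : ∀ k, 0 ≤ noiseExcess p k := fun k => by
      have := tailSq_nonneg k
      unfold noiseExcess
      split_ifs <;> positivity
    have hxm : ∀ j k, j ≤ k → k < p.numEpisodes →
        Measurable[info ℱ a ζ (t k)] fun ω => (x (j + 1) ω).ofLp := by
      intro j k hjk hk
      have h1 : Measurable[info ℱ a ζ (t j)] (x (j + 1)) := hrun.action_meas _ (hep j (by omega))
      have h2 : info ℱ a ζ (t j) ≤ info ℱ a ζ (t k) := by
        rcases hjk.eq_or_lt with rfl | hjk
        · exact le_rfl
        · exact (hrun.info_le (htT j (by omega))).trans (hpast j k hjk)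
      exact (WithLp.measurable_ofLp 2 _).comp (h1.mono h2 le_rfl)
    have hnm : ∀ k < p.numEpisodes, Measurable[ℱ (t k)] fun ω =>
        ∑ j, noiseWeight hG i k j * η j (t k) ω := fun k hk =>
      Finset.measurable_sum _ fun j _ => (hηm k hk j).const_mul _
    have hc : 0 < p.lam - p.L ^ 2 * V := by
      simp only [hVdef]
      split_ifs with h
      · linarith
      · linarith [not_le.1 h]
    have hδ0 : 0 < p.δ / (2 * N) := by positivity
    have hδ1 : p.δ / (2 * N) ≤ 1 := by
      rw [div_le_one (by positivity)]
      linarith [hp.δ_lt]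
    have hmain := measure_exists_noise_gt_le hd (P := P) (M := p.numEpisodes)
      (m := fun k => info ℱ a ζ (t k)) hinfo (X := fun k ω => (x (k + 1) ω).ofLp)
      (n := fun k ω => ∑ j, noiseWeight hG i k j * η j (t k) ω) hxm
      (fun j k hjk hk => (hnm j (by omega)).mono (hpast j k hjk) le_rfl)
      (fun k hk => (hnm k hk).mono (ℱ.le _) le_rfl) (ν := noiseExcess p) hν hς
      (fun k hk => ?_) (L := p.L) (V := V) (c := p.lam - p.L ^ 2 * V) (lam := p.lam)
      (δ := p.δ / (2 * N)) (fun k hk => ?_) (fun s _ => ?_) hc (by linarith) (fun s hs => ?_)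
      hδ0 hδ1
    · refine le_trans (le_of_eq ?_) hmain
      have hgr : ∀ ω s, regGram p.lam (fun k => (x (k + 1) ω).ofLp) s
          = p.gram (fun k => x k ω) s := fun ω s => (gram_eq_regGram (fun k => x k ω) s).symm
      simp only [hgr, noiseRadius, ht]
    · have hνk := hν k
      refine isStandardSubGaussian_sum (hinfo k hk) (hηm' k hk)
        (hrun.noise_subGaussian _ (htT k hk)) (hrun.noise_condIndep _ (htT k hk))
        (by positivity) ?_
      rw [mul_pow, div_pow, Real.sq_sqrt (by positivity), Real.sq_sqrt (by positivity)]
      calc _ ≤ p.R ^ 2 * ((N : ℝ)⁻¹ * (1 + noiseExcess p k)) :=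
            mul_le_mul_of_nonneg_left (sum_sq_noiseWeight_le hG i k) (sq_nonneg _)
        _ = _ := by ring
    · filter_upwards [hrun.action_mem _ (hep k hk)] with ω hω
      rw [← norm_sq_eq_dotProduct]
      have := hp.action_le _ hω
      gcongr
    · simp only [noiseExcess, hVdef]
      split_ifs
      · simp
      · rw [← Finset.mul_sum]
        linarith [sum_tailSq_le_one s]
    · have hs' : (1 : ℝ) ≤ s := by exact_mod_cast hs
      have hd' : (2 : ℝ) ≤ d := by exact_mod_cast hd
      have hL2 := sq_nonneg p.L
      have hsL : 0 ≤ (s : ℝ) * p.L ^ 2 := by positivity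
      simp only [hVdef]
      split_ifs with h
      · rw [add_zero, mul_zero, sub_zero]
        have : (d : ℝ) * p.lam * (s * p.L ^ 2 / p.lam) = d * (s * p.L ^ 2) := by field_simp
        rw [this]
        nlinarith
      -- With `V = 1/4` the lowered regularizer is at least `3λ/4`; then `d ≥ 2` gives the factor
      -- `3/2`, and `s + 1/4 ≤ 3s/2` for `s ≥ 1`.
      · have h1 : (3 / 4 : ℝ) ≤ (p.lam - p.L ^ 2 * (1 / 4)) / p.lam := by
          rw [le_div_iff₀ hl]
          linarith [not_le.1 h]
        have h2 : (d : ℝ) * (p.lam - p.L ^ 2 * (1 / 4)) * (s * p.L ^ 2 / p.lam)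
            = d * ((p.lam - p.L ^ 2 * (1 / 4)) / p.lam) * (s * p.L ^ 2) := by ring
        have h3 : (2 : ℝ) * (3 / 4) ≤ d * ((p.lam - p.L ^ 2 * (1 / 4)) / p.lam) :=
          mul_le_mul hd' h1 (by norm_num) (by positivity)
        rw [h2]
        nlinarith [mul_le_mul_of_nonneg_right h3 hsL]

end Run

end SafeBandit

end

/-! ### Union bound over the agents and conclusions on the good event. -/

theorem mainTheorem2 {Ω : Type*} {mΩ : MeasurableSpace Ω} (P : MeasureTheory.Measure Ω)
    [MeasureTheory.IsProbabilityMeasure P] {N d : ℕ} (hd : 2 ≤ d)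
    (p : SafeBandit.Problem N d) (G : SimpleGraph (Fin N)) (hG : SafeBandit.IsNetwork G p.W)
    (xstar : EuclideanSpace ℝ (Fin d)) (hp : SafeBandit.Admissible p xstar)
    (ℱ : MeasureTheory.Filtration ℕ mΩ) (a : ℕ → Ω → Fin N)
    (ζ : ℕ → Ω → EuclideanSpace ℝ (Fin d)) (η : Fin N → ℕ → Ω → ℝ)
    (x : ℕ → Ω → EuclideanSpace ℝ (Fin d))
    (hrun : SafeBandit.IsRun p P ℱ a ζ η x) :
    ENNReal.ofReal (1 - p.δ / 2) ≤ P {ω |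
      (∀ s ≤ p.numEpisodes, ∀ i : Fin N,
        p.θglobal ∈ p.ellipsoid (fun k => x k ω) (fun i t => η i t ω) s i) ∧
      (∀ s ∈ Finset.Icc 1 p.numEpisodes,
        p.threshold s ≤ SafeBandit.lambdaMin (p.gram (fun k => x k ω) (s - 1)) →
        ∀ i : Fin N,
          xstar ∈ p.safeSet (fun k => x k ω) (fun i t => η i t ω) s i ∧
          (∃ xbar θbar, p.IsUCB (fun k => x k ω) (fun i t => η i t ω) s i xbar θbar) ∧
          ∀ xbar θbar, p.IsUCB (fun k => x k ω) (fun i t => η i t ω) s i xbar θbar →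
            ⟪xstar, p.θglobal⟫ ≤ ⟪xbar, θbar⟫)} := by
  have hN : (0 : ℝ) < N := by have := hG.two_le; positivity
  have hδ := hp.δ_pos
  set bad : Fin N → Set Ω := fun i => {ω | ∃ s ≤ p.numEpisodes, ∃ u : Fin d → ℝ,
    SafeBandit.noiseRadius p s * Real.sqrt (u ⬝ᵥ (p.gram (fun k => x k ω) s *ᵥ u))
      < |∑ k ∈ Finset.range s,
        (∑ j, SafeBandit.noiseWeight hG i k j * η j (p.startRound (k + 1)) ω)
          * (u ⬝ᵥ (x (k + 1) ω).ofLp)|}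
  have hbad : P (⋃ i, bad i) ≤ ENNReal.ofReal (p.δ / 2) := by
    refine (measure_iUnion_fintype_le _ _).trans ?_
    refine (Finset.sum_le_sum fun i _ => hrun.measure_noise_gt_le hd hG hp i).trans_eq ?_
    rw [Finset.sum_const, Finset.card_univ, Fintype.card_fin, nsmul_eq_mul,
      ← ENNReal.ofReal_natCast, ← ENNReal.ofReal_mul hN.le]
    congr 1
    field_simp
  have hae : ∀ᵐ ω ∂P, ∀ k, k < p.numEpisodes → x (k + 1) ω ∈ p.X ∧
      ∀ i, |p.reward (fun k => x k ω) (fun i t => η i t ω) (k + 1) i| ≤ 1 := by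
    refine ae_all_iff.2 fun k => ?_
    by_cases hk : k < p.numEpisodes
    · have hk' : k + 1 ∈ Finset.Icc 1 p.numEpisodes :=
        Finset.mem_Icc.2 ⟨Nat.le_add_left 1 k, hk⟩
      filter_upwards [hrun.action_mem _ hk', ae_all_iff.2 fun i => hrun.reward_bounded _ hk' i]
        with ω h1 h2 _ using ⟨h1, h2⟩
    · exact ae_of_all _ fun ω h => absurd h hk
  set E : Set Ω := {ω |
      (∀ s ≤ p.numEpisodes, ∀ i : Fin N,
        p.θglobal ∈ p.ellipsoid (fun k => x k ω) (fun i t => η i t ω) s i) ∧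
      (∀ s ∈ Finset.Icc 1 p.numEpisodes,
        p.threshold s ≤ SafeBandit.lambdaMin (p.gram (fun k => x k ω) (s - 1)) →
        ∀ i : Fin N,
          xstar ∈ p.safeSet (fun k => x k ω) (fun i t => η i t ω) s i ∧
          (∃ xbar θbar, p.IsUCB (fun k => x k ω) (fun i t => η i t ω) s i xbar θbar) ∧
          ∀ xbar θbar, p.IsUCB (fun k => x k ω) (fun i t => η i t ω) s i xbar θbar →
            ⟪xstar, p.θglobal⟫ ≤ ⟪xbar, θbar⟫)} with hE
  have hgood : ∀ᵐ ω ∂P, ω ∈ E ∪ ⋃ i, bad i := by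
    filter_upwards [hae] with ω hω
    by_cases hb : ω ∈ ⋃ i, bad i
    · exact Or.inr hb
    left
    have hell : ∀ s ≤ p.numEpisodes, ∀ i : Fin N,
        p.θglobal ∈ p.ellipsoid (fun k => x k ω) (fun i t => η i t ω) s i := by
      intro s hs i
      refine SafeBandit.θglobal_mem_ellipsoid hG hp (fun k hk => (hω k (by omega)).2)
        (fun k hk => hp.action_le _ (hω k (by omega)).1) fun u => ?_
      by_contra hlt
      exact hb (Set.mem_iUnion.2 ⟨i, s, hs, u, not_le.1 hlt⟩)
    refine ⟨hell, fun s hs hthr i => ?_⟩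
    have hθ := hell (s - 1) (by have := (Finset.mem_Icc.1 hs).2; omega) i
    have hstar := SafeBandit.xstar_mem_safeSet hp (SafeBandit.startRound_mem_Icc hs) hθ hthr
    -- `(xstar, θglobal)` is itself feasible, hence every maximizer is optimistic.
    exact ⟨hstar, SafeBandit.exists_isUCB hp ⟨_, hstar⟩ ⟨_, hθ⟩,
      fun xbar θbar h => h.2.2 _ hstar _ hθ⟩
  -- Subadditivity on `E ∪ ⋃ bad` replaces passing to complements, so no measurability of `E` is
  -- needed.
  have h1 : 1 ≤ P E + ENNReal.ofReal (p.δ / 2) := by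
    calc (1 : ENNReal) = P Set.univ := measure_univ.symm
      _ ≤ P (E ∪ ⋃ i, bad i) := measure_mono_ae (by
          filter_upwards [hgood] with ω hω _ using hω)
      _ ≤ P E + P (⋃ i, bad i) := measure_union_le _ _
      _ ≤ _ := by gcongr
  rw [ENNReal.ofReal_sub _ (by positivity), ENNReal.ofReal_one]
  exact tsub_le_iff_right.2 h1
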